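/- Let $n\ge 1$, let $\|\cdot\|$ be any norm on $\mathbb{R}^n$ with dual norm $\|y\|_*=\sup_{\|x\|\le 1}x^\top y$, let $p,q\in[1,\infty]$ with $1/p+1/q=1$, and let $\varepsilon\ge 0$. Let $\mathcal M_p(\mathbb{R}^n)$ be the set of probability distributions on $\mathbb{R}^n$ with finite $p$-th moment in each component (essentially bounded components if $p=\infty$). For $F_0\in\mathcal M_p(\mathbb{R}^n)$ let $\mathcal B_p(F_0,\varepsilon)=\{F\in\mathcal M_p(\mathbb{R}^n): W_p(F,F_0)\le\varepsilon\}$, where $W_p(F_1,F_2)=\inf_\pi(\mathbb{E}^\pi\|\xi_1-\xi_2\|^p)^{1/p}$ (for $p=\infty$: $\inf_\pi\operatorname{ess\,sup}_\pi\|\xi_1-\xi_2\|$), the infimum being over all joint distributions $\pi$ of $(\xi_1,\xi_2)$ with marginals $F_1$ and $F_2$. Let $h:[0,1]\to\mathbb{R}$ be convex and continuous. For a real random variable $Z$ whose distribution function under $F$ is $G$, put $\rho_h^F(Z)=\int_0^1 G^{-1}(s)\,\mathrm{d}h(s)$ (a Lebesgue–Stieltjes integral), where $G^{-1}(s)=\inf\{x:G(x)\ge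 s\}$ for $s\in(0,1]$ and $G^{-1}(0)=\inf\{x:G(x)>0\}$. Let $h'_-$ be the left derivative of $h$ and, for $g$ on $(0,1)$, let $\|g\|_q=(\int_0^1|g(s)|^q\,\mathrm{d}s)^{1/q}$ (the essential supremum of $|g|$ if $q=\infty$). The values $\rho_h^F$ and $\|\cdot\|_q$ may be $+\infty$; the identities below hold in $(-\infty,+\infty]$ (with $\inf\emptyset=+\infty$) and use $\infty\cdot 0=0$. Below, $\mathbf X\sim F$ under $F$ and $\mathbf X\sim F_0$ under $F_0$. (i) For every $\beta\in\mathbb{R}^n$, $$\sup_{F\in\mathcal B_p(F_0,\varepsilon)}\rho_h^F\big(\beta^\top\mathbf X-\mathbb{E}^F[\beta^\top\mathbf X]\big)=\rho_h^{F_0}\big(\beta^\top\mathbf X-\mathbb{E}^{F_0}[\beta^\top\mathbf X]\big)+\|h'_-+h(0)-h(1)\|_q\,\varepsilon\,\|\beta\|_*;$$ hence for every $\mathcal D\subseteq\mathbb{R}^n$ the infimum over $\beta\in\mathcal D$ of the left-hand side equals that of the right-hand side. (ii) If moreover $h$ is increasing (in the weak sense), then for every $\beta_r\in\mathbb{R}^{n-1}$,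 $$\sup_{F\in\mathcal B_p(F_0,\varepsilon)}\rho_h^F\big(|(1,-\beta_r)^\top\mathbf X|\big)=\rho_h^{F_0}\big(|(1,-\beta_r)^\top\mathbf X|\big)+\|h'_-\|_q\,\varepsilon\,\|(1,-\beta_r)\|_*;$$ hence for every $\mathcal D\subseteq\mathbb{R}^{n-1}$ the infimum over $\beta_r\in\mathcal D$ of the left-hand side equals that of the right-hand side. -/

import Mathlib

open MeasureTheory Set
open scoped ENNReal

noncomputable section

namespace WassersteinDRO

/-- The class of distributions on `ℝⁿ` whose components all have a finite `p`-th moment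
(for `p = ∞`: all components are essentially bounded). -/
def finiteMoment {n : ℕ} (p : ℝ≥0∞) : Set (Measure (Fin n → ℝ)) :=
  {F | IsProbabilityMeasure F ∧ ∀ i, MemLp (fun x : Fin n → ℝ => x i) p F}

/-- The joint distributions with marginals `F₁` and `F₂`. -/
def couplings {n : ℕ} (F₁ F₂ : Measure (Fin n → ℝ)) :
    Set (Measure ((Fin n → ℝ) × (Fin n → ℝ))) :=
  {π | π.map Prod.fst = F₁ ∧ π.map Prod.snd = F₂}

/-- The type-`p` Wasserstein distance on `ℝⁿ` for the transport cost given by `N`, that is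
`inf_π (E^π[N(ξ₁ - ξ₂)^p])^(1/p)`, with the essential supremum of `N(ξ₁ - ξ₂)` for `p = ∞`. -/
def wasserstein {n : ℕ} (N : Seminorm ℝ (Fin n → ℝ)) (p : ℝ≥0∞)
    (F₁ F₂ : Measure (Fin n → ℝ)) : ℝ≥0∞ :=
  ⨅ π ∈ couplings F₁ F₂, eLpNorm (fun z : (Fin n → ℝ) × (Fin n → ℝ) => N (z.1 - z.2)) p π

/-- The type-`p` Wasserstein ball with centre `F₀` and radius `ε`. -/
def wassersteinBall {n : ℕ} (N : Seminorm ℝ (Fin n → ℝ)) (p : ℝ≥0∞)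
    (F₀ : Measure (Fin n → ℝ)) (ε : ℝ) : Set (Measure (Fin n → ℝ)) :=
  {F | F ∈ finiteMoment p ∧ wasserstein N p F F₀ ≤ ENNReal.ofReal ε}

/-- The dual norm `‖y‖_* = sup {xᵀ y : ‖x‖ ≤ 1}`. -/
def dualNorm {n : ℕ} (N : Seminorm ℝ (Fin n → ℝ)) (y : Fin n → ℝ) : ℝ :=
  sSup ((fun x : Fin n → ℝ => x ⬝ᵥ y) '' {x | N x ≤ 1})

/-- The left-quantile function `F⁻¹(s) = inf {x : F(x) ≥ s}` for `s ∈ (0, 1]`, and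
`F⁻¹(0) = inf {x : F(x) > 0}`, of a distribution `μ` on `ℝ`. It can be infinite at `0` and `1`. -/
def quantile (μ : Measure ℝ) (s : ℝ) : EReal :=
  if s = 0 then ⨅ x : ℝ, ⨅ _ : 0 < ProbabilityTheory.cdf μ x, (x : EReal)
  else ⨅ x : ℝ, ⨅ _ : s ≤ ProbabilityTheory.cdf μ x, (x : EReal)

open scoped Classical in
/-- The Lebesgue-Stieltjes signed measure `dh` of a function `h` of bounded variation on `[0, 1]`,
as a measure on `ℝ` carried by `[0, 1]`: `h` is extended by `h 0` to the left of `0` and by `h 1`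
to the right of `1`. (Any convex `h` on `[0, 1]` is of bounded variation.) -/
def stieltjes (h : ℝ → ℝ) : SignedMeasure ℝ :=
  if hbv : BoundedVariationOn (fun s : ℝ => h (projIcc (0 : ℝ) 1 zero_le_one s)) univ then
    hbv.vectorMeasure
  else 0

/-- The distortion functional `∫₀¹ F⁻¹(s) dh(s)` of a distribution `μ` on `ℝ`, with values in the
extended reals: the integral of the positive part of the integrand minus that of its negative
part, where `dh` is split by its Jordan decomposition. For convex `h` that is continuous on
`[0, 1]` and `μ` with a finite mean the subtracted term is finite. -/
def distortion (h : ℝ → ℝ) (μ : Measure ℝ) : EReal :=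
  (((∫⁻ s, (quantile μ s).toENNReal ∂(stieltjes h).toJordanDecomposition.posPart) +
      (∫⁻ s, (-quantile μ s).toENNReal ∂(stieltjes h).toJordanDecomposition.negPart) : ℝ≥0∞) :
        EReal) -
    (((∫⁻ s, (-quantile μ s).toENNReal ∂(stieltjes h).toJordanDecomposition.posPart) +
      (∫⁻ s, (quantile μ s).toENNReal ∂(stieltjes h).toJordanDecomposition.negPart) : ℝ≥0∞) :
        EReal)

/-- The deviation `ρ_h^F(βᵀX - E^F[βᵀX])` for `X ∼ F`. -/
def deviationRisk {n : ℕ} (h : ℝ → ℝ) (F : Measure (Fin n → ℝ)) (β : Fin n → ℝ) : EReal :=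
  distortion h (F.map (fun x => (β ⬝ᵥ x) - (∫ y, (β ⬝ᵥ y) ∂F)))

/-- The risk `ρ_h^F(|βᵀX|)` for `X ∼ F`. -/
def absoluteRisk {n : ℕ} (h : ℝ → ℝ) (F : Measure (Fin n → ℝ)) (β : Fin n → ℝ) : EReal :=
  distortion h (F.map (fun x => |β ⬝ᵥ x|))

/-- The left derivative of `h`. -/
def leftDeriv (h : ℝ → ℝ) (s : ℝ) : ℝ := derivWithin h (Iio s) s

/-- `‖g‖_q`, the `L^q` norm of `g` on the interval `(0, 1)`, possibly infinite. -/
def unitNorm (q : ℝ≥0∞) (g : ℝ → ℝ) : ℝ≥0∞ := eLpNorm g q (volume.restrict (Ioo (0 : ℝ) 1))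

end WassersteinDRO

end

open WassersteinDRO

open Filter Topology ProbabilityTheory

namespace WassersteinDRO

/-! Since `h` is convex and continuous, `dh` has density `leftDeriv h` on (0,1). Both risks
therefore take the form ∫ g_F φ over (0,1), where g_F is the quantile function of T(X) under F and φ
is monotone. In (i), T(x) = β·x and φ = h'₋ + h(0) - h(1), the constant absorbing the centring. In
(ii), T(x) = |β·x| and φ = h'₋. In both cases T is Lipschitz for `N` with constant L = ‖β‖_*, and
`iSup_extIntegral_eq` treats them together.

The tool is the Hardy–Littlewood inequality E[Z φ(U)] ≤ ∫ g_Z φ for uniform U, with equality when Z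
= g_Z(U); `exists_uniform_realQuantile` supplies such a U for any Z.

Upper bound: given a coupling (ξ₁, ξ₂) of F and F₀, choose U with T(ξ₁) = g_F(U). The difference of
the two risks is then at most E[(T(ξ₁) - T(ξ₂)) φ(U)], and Hölder's inequality with the Lipschitz
bound finishes.

Lower bound: choose U with T(ξ) = g_{F₀}(U) for ξ ∼ F₀, and move ξ by ε w(U) along a direction d
where the dual norm is attained, with w nearly extremal in Hölder's inequality. This raises T by
exactly ε w(U) L, and Hardy–Littlewood bounds the new risk from below.

Infinite values are handled by truncating φ and by the fact that the negative part of g_F φ is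
always integrable. -/

/-! ### Calculus with left derivatives. -/

theorem hasDerivWithinAt_neg_comp_neg {f : ℝ → ℝ} {f' x : ℝ}
    (hf : HasDerivWithinAt f f' (Iio (-x)) (-x)) :
    HasDerivWithinAt (fun y => -f (-y)) f' (Ioi x) x := by
  have h2 : HasDerivWithinAt (fun y : ℝ => -y) (-1) (Ioi x) x :=
    (hasDerivAt_neg x).hasDerivWithinAt
  have h3 := (hf.scomp x h2 (fun y (hy : x < y) => (neg_lt_neg hy : -y < -x))).neg
  rw [smul_eq_mul, neg_one_mul, neg_neg] at h3
  exact h3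

/-- The fundamental theorem of calculus for a left derivative. -/
theorem integral_eq_sub_of_hasDerivWithinAt_Iio {f f' : ℝ → ℝ} {a b : ℝ} (hab : a ≤ b)
    (hcont : ContinuousOn f (Icc a b))
    (hderiv : ∀ x ∈ Ioo a b, HasDerivWithinAt f (f' x) (Iio x) x)
    (hint : IntervalIntegrable f' volume a b) : ∫ x in a..b, f' x = f b - f a := by
  -- The reflection x ↦ -f(-x) turns left derivatives into right derivatives.
  have key : ∫ x in (-b)..(-a), f' (-x) = (fun x => -f (-x)) (-a) - (fun x => -f (-x)) (-b) := by
    refine intervalIntegral.integral_eq_sub_of_hasDeriv_right_of_le (f := fun x => -f (-x))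
      (f' := fun x => f' (-x)) (neg_le_neg hab) ?_ ?_ ?_
    · refine (hcont.comp continuous_neg.continuousOn ?_).neg
      intro x hx
      exact ⟨by linarith [hx.2], by linarith [hx.1]⟩
    · intro x hx
      exact hasDerivWithinAt_neg_comp_neg
        (hderiv (-x) ⟨by linarith [hx.2], by linarith [hx.1]⟩)
    · exact ((IntervalIntegrable.iff_comp_neg (by finiteness)).mp hint).symm
  rw [intervalIntegral.integral_comp_neg (fun x => f' x)] at key
  simp only [neg_neg] at key
  rw [key]; ring

theorem integrableOn_of_hasDerivWithinAt_Iio_nonneg {f f' : ℝ → ℝ} {a b : ℝ} (hab : a ≤ b)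
    (hcont : ContinuousOn f (Icc a b))
    (hderiv : ∀ x ∈ Ioo a b, HasDerivWithinAt f (f' x) (Iio x) x)
    (hpos : ∀ x ∈ Ioo a b, 0 ≤ f' x) : IntervalIntegrable f' volume a b := by
  have key : IntegrableOn (fun x => f' (-x)) (Ioc (-b) (-a)) := by
    refine intervalIntegral.integrableOn_deriv_right_of_nonneg (g := fun x => -f (-x)) ?_ ?_ ?_
    · refine (hcont.comp continuous_neg.continuousOn ?_).neg
      intro x hx
      exact ⟨by linarith [hx.2], by linarith [hx.1]⟩
    · intro x hx
      exact hasDerivWithinAt_neg_comp_neg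
        (hderiv (-x) ⟨by linarith [hx.2], by linarith [hx.1]⟩)
    · intro x hx
      exact hpos (-x) ⟨by linarith [hx.2], by linarith [hx.1]⟩
  have h2 := (intervalIntegrable_iff_integrableOn_Ioc_of_le (neg_le_neg hab)).mpr key
  exact (IntervalIntegrable.iff_comp_neg (by finiteness)).mpr h2.symm

/-! ### The signed measure `dh` of a convex function. -/

section Convex

variable {h : ℝ → ℝ} (hconv : ConvexOn ℝ (Icc 0 1) h) (hcont : ContinuousOn h (Icc 0 1))
include hconv

theorem hasDerivWithinAt_leftDeriv {x : ℝ} (hx : x ∈ Ioo (0 : ℝ) 1) :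
    HasDerivWithinAt h (leftDeriv h x) (Iio x) x :=
  hconv.hasDerivWithinAt_leftDeriv_of_mem_interior (by rwa [interior_Icc])

theorem monotoneOn_leftDeriv : MonotoneOn (leftDeriv h) (Ioo 0 1) := by
  have := hconv.monotoneOn_leftDeriv
  rwa [interior_Icc] at this

include hcont

/-- Subtracting the line of slope h'₋(1/2) gives the monotone derivative a constant sign on each
half of the interval, and a one-signed derivative of a continuous function is integrable. -/
theorem intervalIntegrable_leftDeriv : IntervalIntegrable (leftDeriv h) volume 0 1 := by
  have hmono := monotoneOn_leftDeriv hconv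
  set m := leftDeriv h (1 / 2) with hm
  have hlin : ∀ x : ℝ, HasDerivAt (fun y : ℝ => m * y) m x := fun x => by
    simpa using (hasDerivAt_id x).const_mul m
  have h1 : IntervalIntegrable (fun x => leftDeriv h x - m) volume (1 / 2) 1 := by
    refine integrableOn_of_hasDerivWithinAt_Iio_nonneg (f := fun x => h x - m * x) (by norm_num)
      ((hcont.mono (Icc_subset_Icc (by norm_num) le_rfl)).sub (by fun_prop)) (fun x hx => ?_)
      (fun x hx => ?_)
    · exact (hasDerivWithinAt_leftDeriv hconv ⟨by linarith [hx.1], hx.2⟩).sub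
        (hlin x).hasDerivWithinAt
    · exact sub_nonneg.mpr (hmono ⟨by norm_num, by norm_num⟩ ⟨by linarith [hx.1], hx.2⟩ hx.1.le)
  have h0 : IntervalIntegrable (fun x => m - leftDeriv h x) volume 0 (1 / 2) := by
    refine integrableOn_of_hasDerivWithinAt_Iio_nonneg (f := fun x => m * x - h x) (by norm_num)
      (ContinuousOn.sub (by fun_prop) (hcont.mono (Icc_subset_Icc le_rfl (by norm_num))))
      (fun x hx => ?_) (fun x hx => ?_)
    · exact (hlin x).hasDerivWithinAt.sub
        (hasDerivWithinAt_leftDeriv hconv ⟨hx.1, by linarith [hx.2]⟩)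
    · exact sub_nonneg.mpr (hmono ⟨hx.1, by linarith [hx.2]⟩ ⟨by norm_num, by norm_num⟩ hx.2.le)
  have h1' := h1.add (intervalIntegrable_const (c := m))
  have h0' := (intervalIntegrable_const (c := m)).sub h0
  simp only [sub_add_cancel, sub_sub_cancel] at h1' h0'
  exact h0'.trans h1'

theorem integral_leftDeriv {a b : ℝ} (ha : 0 ≤ a) (hab : a ≤ b) (hb : b ≤ 1) :
    ∫ x in a..b, leftDeriv h x = h b - h a := by
  refine integral_eq_sub_of_hasDerivWithinAt_Iio hab (hcont.mono (Icc_subset_Icc ha hb))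
    (fun x hx => hasDerivWithinAt_leftDeriv hconv ⟨ha.trans_lt hx.1, hx.2.trans_le hb⟩) ?_
  refine (intervalIntegrable_leftDeriv hconv hcont).mono_set ?_
  rw [uIcc_of_le hab, uIcc_of_le zero_le_one]
  exact Icc_subset_Icc ha hb

theorem integrableOn_leftDeriv : IntegrableOn (leftDeriv h) (Ioo 0 1) := by
  rw [← integrableOn_Ioc_iff_integrableOn_Ioo]
  exact (intervalIntegrable_iff_integrableOn_Ioc_of_le zero_le_one).mp
    (intervalIntegrable_leftDeriv hconv hcont)

theorem setIntegral_Ioc_leftDeriv {a b : ℝ} (hab : a ≤ b) :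
    ∫ x in Ioc a b, leftDeriv h x ∂(volume.restrict (Ioo 0 1)) =
      h (projIcc (0 : ℝ) 1 zero_le_one b) - h (projIcc (0 : ℝ) 1 zero_le_one a) := by
  have hab' : (projIcc (0 : ℝ) 1 zero_le_one a : ℝ) ≤ projIcc (0 : ℝ) 1 zero_le_one b :=
    monotone_projIcc _ hab
  rw [← integral_leftDeriv hconv hcont (projIcc (0 : ℝ) 1 zero_le_one a).2.1 hab'
    (projIcc (0 : ℝ) 1 zero_le_one b).2.2, intervalIntegral.integral_of_le hab',
    Measure.restrict_congr_set (Ioo_ae_eq_Ioc (a := (0:ℝ)) (b := 1)),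
    Measure.restrict_restrict measurableSet_Ioc]
  congr 2
  ext x
  simp only [coe_projIcc, mem_inter_iff, mem_Ioc]
  constructor
  · rintro ⟨⟨h1, h2⟩, h3, h4⟩
    refine ⟨max_lt h3 ((min_le_right _ _).trans_lt h1), le_max_of_le_right (le_min h4 h2)⟩
  · rintro ⟨h1, h2⟩
    rw [max_lt_iff, min_lt_iff] at h1
    rw [le_max_iff, le_min_iff] at h2
    rcases h2 with h2 | ⟨h2, h2'⟩
    · exact absurd h1.1 (not_lt.mpr h2)
    · rcases h1.2 with h3 | h3
      · exact absurd h3 (not_lt.mpr h2)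
      · exact ⟨⟨h3, h2'⟩, h1.1, h2⟩

/-- The increments of a primitive are dominated by those of the monotone primitive `V` of |h'₋|.
This selects the nontrivial branch in `stieltjes`. -/
theorem boundedVariationOn_comp_projIcc :
    BoundedVariationOn (fun s : ℝ => h (projIcc (0 : ℝ) 1 zero_le_one s)) univ := by
  have hint : IntegrableOn (fun x => |leftDeriv h x|) (Ioo 0 1) :=
    (integrableOn_leftDeriv hconv hcont).abs
  set V : ℝ → ℝ := fun s => ∫ x in Iic s, |leftDeriv h x| ∂(volume.restrict (Ioo 0 1)) with hV
  have hVsub : ∀ a b, a ≤ b →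
      V b - V a = ∫ x in Ioc a b, |leftDeriv h x| ∂(volume.restrict (Ioo 0 1)) := by
    intro a b hab
    have := setIntegral_union (μ := volume.restrict (Ioo (0:ℝ) 1))
      (f := fun x => |leftDeriv h x|) (Iic_disjoint_Ioc (le_refl a) (c := b)) measurableSet_Ioc
      hint.integrableOn hint.integrableOn
    rw [Iic_union_Ioc_eq_Iic hab] at this
    simp only [hV]
    rw [this]; ring
  have hVmono : Monotone V := fun a b hab => by
    have := hVsub a b hab
    have h2 : 0 ≤ ∫ x in Ioc a b, |leftDeriv h x| ∂(volume.restrict (Ioo 0 1)) :=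
      integral_nonneg fun x => abs_nonneg _
    linarith
  have hVbv : BoundedVariationOn V univ := by
    refine (hVmono.monotoneOn univ).boundedVariationOn
      (C := ∫ x in Ioo 0 1, |leftDeriv h x|) fun x _ => ?_
    rw [abs_of_nonneg (integral_nonneg fun x => abs_nonneg _)]
    exact integral_mono_measure Measure.restrict_le_self (ae_of_all _ fun x => abs_nonneg _) hint
  refine ne_top_of_le_ne_top hVbv ?_
  refine iSup_mono fun p => Finset.sum_le_sum fun i _ => ?_
  have hle : p.2.1 i ≤ p.2.1 (i + 1) := p.2.2.1 (Nat.le_succ i)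
  rw [edist_dist, edist_dist]
  refine ENNReal.ofReal_le_ofReal ?_
  rw [Real.dist_eq, Real.dist_eq, hVsub _ _ hle, ← setIntegral_Ioc_leftDeriv hconv hcont hle,
    abs_of_nonneg (integral_nonneg fun x => abs_nonneg _)]
  exact abs_integral_le_integral_abs

/-- Both sides agree on half-open intervals and on the whole line. Continuity of `h` rules out atoms
at 0 and 1, so the possibly infinite quantiles there play no role. -/
theorem stieltjes_eq_withDensity :
    stieltjes h = (volume.restrict (Ioo (0 : ℝ) 1)).withDensityᵥ (leftDeriv h) := by
  have hbv := boundedVariationOn_comp_projIcc hconv hcont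
  have hint : Integrable (leftDeriv h) (volume.restrict (Ioo 0 1)) :=
    integrableOn_leftDeriv hconv hcont
  have hc : Continuous fun s : ℝ => h (projIcc (0 : ℝ) 1 zero_le_one s) := by
    have := (continuousOn_iff_continuous_domRestrict.mp hcont).comp
      (continuous_projIcc (a := (0 : ℝ)) (b := 1) (h := zero_le_one))
    exact this
  rw [stieltjes, dif_pos hbv]
  refine VectorMeasure.ext_of_generateFrom _ ?_
    ((BorelSpace.measurable_eq (α := ℝ)).trans (borel_eq_generateFrom_Ioc ℝ))
    (isPiSystem_Ioc id id) ?_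
  · rintro s ⟨a, b, hab, rfl⟩
    change a < b at hab
    rw [hbv.vectorMeasure_Ioc hab.le, withDensityᵥ_apply hint measurableSet_Ioc,
      setIntegral_Ioc_leftDeriv hconv hcont hab.le,
      rightLim_eq_of_tendsto (hc.tendsto b |>.mono_left nhdsWithin_le_nhds),
      rightLim_eq_of_tendsto (hc.tendsto a |>.mono_left nhdsWithin_le_nhds)]
  · rw [hbv.vectorMeasure_univ, withDensityᵥ_apply hint MeasurableSet.univ, Measure.restrict_univ,
      ← integral_Ioc_eq_integral_Ioo, ← intervalIntegral.integral_of_le zero_le_one,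
      integral_leftDeriv hconv hcont le_rfl zero_le_one le_rfl]
    congr 1
    · refine Tendsto.limUnder_eq (tendsto_const_nhds.congr' ?_)
      filter_upwards [eventually_ge_atTop 1] with s hs
      simp [projIcc_of_right_le _ hs]
    · refine Tendsto.limUnder_eq (tendsto_const_nhds.congr' ?_)
      filter_upwards [eventually_le_atBot 0] with s hs
      simp [projIcc_of_le_left _ hs]

theorem toJordanDecomposition_stieltjes :
    (stieltjes h).toJordanDecomposition.posPart =
        (volume.restrict (Ioo (0 : ℝ) 1)).withDensity (fun s => ENNReal.ofReal (leftDeriv h s)) ∧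
      (stieltjes h).toJordanDecomposition.negPart =
        (volume.restrict (Ioo (0 : ℝ) 1)).withDensity
          (fun s => ENNReal.ofReal (-leftDeriv h s)) := by
  have hint : Integrable (leftDeriv h) (volume.restrict (Ioo 0 1)) :=
    integrableOn_leftDeriv hconv hcont
  obtain ⟨f, hfm, hf⟩ := hint.aemeasurable
  have hfint : Integrable f (volume.restrict (Ioo 0 1)) := hint.congr hf
  have hs : stieltjes h = 0 + (volume.restrict (Ioo (0 : ℝ) 1)).withDensityᵥ f := by
    rw [zero_add, stieltjes_eq_withDensity hconv hcont]
    exact WithDensityᵥEq.congr_ae hf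
  have key := SignedMeasure.toJordanDecomposition_eq_of_eq_add_withDensity hfm hfint
    VectorMeasure.MutuallySingular.zero_left hs
  rw [key]
  simp only [SignedMeasure.toJordanDecomposition_zero, JordanDecomposition.zero_posPart,
    JordanDecomposition.zero_negPart, zero_add]
  constructor
  · exact withDensity_congr_ae (by filter_upwards [hf] with s hs; rw [hs])
  · exact withDensity_congr_ae (by filter_upwards [hf] with s hs; rw [hs])

end Convex

/-! ### Extended integrals -/

section ExtIntegral

variable {α : Type*} [MeasurableSpace α] {ν : Measure α} {f g : α → ℝ}

/-- The integral of the positive part minus that of the negative part, in the extended reals. -/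
noncomputable def extIntegral (ν : Measure α) (f : α → ℝ) : EReal :=
  ((∫⁻ x, ENNReal.ofReal (f x) ∂ν : ℝ≥0∞) : EReal) -
    ((∫⁻ x, ENNReal.ofReal (-f x) ∂ν : ℝ≥0∞) : EReal)

theorem extIntegral_congr (hfg : f =ᵐ[ν] g) : extIntegral ν f = extIntegral ν g := by
  have h1 : (fun x => ENNReal.ofReal (f x)) =ᵐ[ν] fun x => ENNReal.ofReal (g x) := by
    filter_upwards [hfg] with x hx
    rw [hx]
  have h2 : (fun x => ENNReal.ofReal (-f x)) =ᵐ[ν] fun x => ENNReal.ofReal (-g x) := by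
    filter_upwards [hfg] with x hx
    rw [hx]
  rw [extIntegral, extIntegral, lintegral_congr_ae h1, lintegral_congr_ae h2]

theorem extIntegral_eq_integral (hf : Integrable f ν) :
    extIntegral ν f = ((∫ x, f x ∂ν : ℝ) : EReal) := by
  have h1 : ∫⁻ x, ENNReal.ofReal (f x) ∂ν ≠ ∞ := hf.lintegral_lt_top.ne
  have h2 : ∫⁻ x, ENNReal.ofReal (-f x) ∂ν ≠ ∞ := hf.neg.lintegral_lt_top.ne
  rw [extIntegral, integral_eq_lintegral_pos_part_sub_lintegral_neg_part hf, EReal.coe_sub,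
    EReal.coe_ennreal_toReal h1, EReal.coe_ennreal_toReal h2]

theorem integrable_of_lintegral_ne_top (hm : AEMeasurable f ν)
    (h1 : ∫⁻ x, ENNReal.ofReal (f x) ∂ν ≠ ∞) (h2 : ∫⁻ x, ENNReal.ofReal (-f x) ∂ν ≠ ∞) :
    Integrable f ν := by
  refine ⟨hm.aestronglyMeasurable, ?_⟩
  have : ∀ x, ‖f x‖ₑ = ENNReal.ofReal (f x) + ENNReal.ofReal (-f x) := fun x => by
    rw [Real.enorm_eq_ofReal_abs]
    rcases le_total 0 (f x) with h | h
    · rw [abs_of_nonneg h, ENNReal.ofReal_of_nonpos (by linarith : -f x ≤ 0), add_zero]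
    · rw [abs_of_nonpos h, ENNReal.ofReal_of_nonpos h, zero_add]
  rw [HasFiniteIntegral, lintegral_congr this, lintegral_add_left' hm.ennreal_ofReal]
  exact ENNReal.add_lt_top.mpr ⟨h1.lt_top, h2.lt_top⟩

theorem extIntegral_eq_top (hm : AEMeasurable f ν) (h2 : ∫⁻ x, ENNReal.ofReal (-f x) ∂ν ≠ ∞)
    (hf : ¬ Integrable f ν) : extIntegral ν f = ⊤ := by
  have h1 : ∫⁻ x, ENNReal.ofReal (f x) ∂ν = ∞ := by
    by_contra h1
    exact hf (integrable_of_lintegral_ne_top hm h1 h2)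
  rw [extIntegral, h1, EReal.coe_ennreal_top, ← EReal.coe_ennreal_toReal h2]
  exact EReal.top_sub_coe _

theorem lintegral_neg_ne_top_of_le (hg : Integrable g ν) (hgf : ∀ᵐ x ∂ν, g x ≤ f x) :
    ∫⁻ x, ENNReal.ofReal (-f x) ∂ν ≠ ∞ := by
  refine ne_top_of_le_ne_top hg.neg.lintegral_lt_top.ne (lintegral_mono_ae ?_)
  filter_upwards [hgf] with x hx
  exact ENNReal.ofReal_le_ofReal (neg_le_neg hx)

/-- Used to absorb the centring of the deviation; it must also cover the value +∞, where adding an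
integrable function cannot restore integrability. -/
theorem extIntegral_add_of_integral_eq_zero (hm : AEMeasurable f ν)
    (h2 : ∫⁻ x, ENNReal.ofReal (-f x) ∂ν ≠ ∞) (hg : Integrable g ν) (hg0 : ∫ x, g x ∂ν = 0) :
    extIntegral ν (fun x => f x + g x) = extIntegral ν f := by
  by_cases hf : Integrable f ν
  · rw [extIntegral_eq_integral hf, extIntegral_eq_integral (f := fun x => f x + g x) (hf.add hg),
      integral_add hf hg, hg0, add_zero]
  · rw [extIntegral_eq_top hm h2 hf]
    refine extIntegral_eq_top (hm.add hg.aemeasurable) ?_ fun h => hf ?_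
    · refine ne_top_of_le_ne_top
        (ENNReal.add_ne_top.mpr ⟨h2, hg.neg.lintegral_lt_top.ne⟩)
        (le_trans (lintegral_mono fun x => ?_) (lintegral_add_left' hm.neg.ennreal_ofReal _).le)
      simp only [Pi.neg_apply, neg_add]
      exact ENNReal.ofReal_add_le
    · exact (h.sub hg).congr (ae_of_all _ fun x => by simp)

end ExtIntegral

/-! ### Quantiles -/

section Quantile

variable {μ : Measure ℝ}

theorem quantile_monotone : Monotone (quantile μ) := by
  intro s t hst
  unfold quantile
  split_ifs with h1 h2 h2
  · exact le_rfl
  · have ht : 0 < t := lt_of_le_of_ne (h1 ▸ hst) (Ne.symm h2)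
    exact le_iInf₂ fun x hx => iInf₂_le (f := fun (x : ℝ) (_ : 0 < cdf μ x) => (x : EReal)) x
      (ht.trans_le hx)
  · have hs : s ≤ 0 := h2 ▸ hst
    exact le_iInf₂ fun x hx => iInf₂_le (f := fun (x : ℝ) (_ : s ≤ cdf μ x) => (x : EReal)) x
      (hs.trans hx.le)
  · exact le_iInf₂ fun x hx => iInf₂_le (f := fun (x : ℝ) (_ : s ≤ cdf μ x) => (x : EReal)) x
      (hst.trans hx)

/-- Right continuity of the distribution function makes the infimum attained, hence a Galois
connection. -/
theorem quantile_le_coe_iff [IsProbabilityMeasure μ] {s : ℝ} (hs : 0 < s) (x : ℝ) :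
    quantile μ s ≤ x ↔ s ≤ cdf μ x := by
  rw [quantile, if_neg hs.ne']
  refine ⟨fun h => ?_, fun h => iInf₂_le x h⟩
  by_contra! hlt
  have hr : Tendsto (cdf μ) (𝓝[>] x) (𝓝 (cdf μ x)) :=
    ((cdf μ).right_continuous x).mono_left (nhdsWithin_mono x Ioi_subset_Ici_self)
  obtain ⟨y, hy, hxy⟩ := ((hr.eventually (gt_mem_nhds hlt)).and self_mem_nhdsWithin).exists
  have : (y : EReal) ≤ ⨅ z : ℝ, ⨅ _ : s ≤ cdf μ z, (z : EReal) := by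
    refine le_iInf₂ fun z hz => ?_
    rw [EReal.coe_le_coe_iff]
    by_contra! hzy
    exact absurd (hz.trans (monotone_cdf μ hzy.le)) (not_le.mpr hy)
  exact absurd (EReal.coe_le_coe_iff.mp (this.trans h)) (not_le.mpr hxy)

/-- The left-quantile function with real values; it is only relevant on `(0, 1)`. -/
noncomputable def realQuantile (μ : Measure ℝ) (s : ℝ) : ℝ := (quantile μ s).toReal

theorem measurable_realQuantile : Measurable (realQuantile μ) :=
  quantile_monotone.measurable.ereal_toReal

variable [IsProbabilityMeasure μ]

theorem coe_realQuantile {s : ℝ} (hs : s ∈ Ioo (0 : ℝ) 1) :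
    (realQuantile μ s : EReal) = quantile μ s := by
  refine EReal.coe_toReal ?_ ?_
  · obtain ⟨x, hx⟩ := ((tendsto_cdf_atTop μ).eventually (lt_mem_nhds hs.2)).exists
    exact ne_top_of_le_ne_top (EReal.coe_ne_top x) ((quantile_le_coe_iff hs.1 x).mpr hx.le)
  · obtain ⟨x, hx⟩ := ((tendsto_cdf_atBot μ).eventually (gt_mem_nhds hs.1)).exists
    intro hbot
    have := (quantile_le_coe_iff (μ := μ) hs.1 x).mp (hbot ▸ bot_le)
    exact absurd this (not_le.mpr hx)

theorem realQuantile_le_iff {s : ℝ} (hs : s ∈ Ioo (0 : ℝ) 1) (x : ℝ) :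
    realQuantile μ s ≤ x ↔ s ≤ cdf μ x := by
  rw [← quantile_le_coe_iff hs.1, ← coe_realQuantile hs, EReal.coe_le_coe_iff]

theorem monotoneOn_realQuantile : MonotoneOn (realQuantile μ) (Ioo 0 1) := fun s hs t ht hst => by
  rw [← EReal.coe_le_coe_iff, coe_realQuantile hs, coe_realQuantile ht]
  exact quantile_monotone hst

instance : IsProbabilityMeasure (volume.restrict (Ioo (0 : ℝ) 1)) :=
  ⟨by simp⟩

theorem map_realQuantile : (volume.restrict (Ioo (0 : ℝ) 1)).map (realQuantile μ) = μ := by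
  have : IsProbabilityMeasure ((volume.restrict (Ioo (0 : ℝ) 1)).map (realQuantile μ)) :=
    Measure.isProbabilityMeasure_map measurable_realQuantile.aemeasurable
  refine Measure.ext_of_Iic _ _ fun x => ?_
  rw [Measure.map_apply measurable_realQuantile measurableSet_Iic,
    Measure.restrict_apply (measurable_realQuantile measurableSet_Iic), ← ofReal_cdf μ x]
  have : realQuantile μ ⁻¹' Iic x ∩ Ioo 0 1 = Iic (cdf μ x) ∩ Ioo 0 1 := by
    ext s
    simp only [mem_inter_iff, mem_preimage, mem_Iic]
    exact and_congr_left fun hs => realQuantile_le_iff hs x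
  rw [this, ← Measure.restrict_apply measurableSet_Iic,
    Measure.restrict_congr_set (Ioo_ae_eq_Ioc (a := (0 : ℝ)) (b := 1)),
    Measure.restrict_apply measurableSet_Iic]
  have : Iic (cdf μ x) ∩ Ioc 0 1 = Ioc 0 (cdf μ x) := by
    ext s
    simp only [mem_inter_iff, mem_Iic, mem_Ioc]
    exact ⟨fun h => ⟨h.2.1, h.1⟩, fun h => ⟨h.2, h.1, h.2.trans (cdf_le_one μ x)⟩⟩
  rw [this, Real.volume_Ioc, sub_zero]

theorem integrable_realQuantile (hμ : Integrable id μ) :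
    Integrable (realQuantile μ) (volume.restrict (Ioo (0 : ℝ) 1)) := by
  have h : Integrable id ((volume.restrict (Ioo (0 : ℝ) 1)).map (realQuantile μ)) := by
    rwa [map_realQuantile]
  exact (integrable_map_measure aestronglyMeasurable_id
    measurable_realQuantile.aemeasurable).mp h

theorem integral_realQuantile :
    ∫ s, realQuantile μ s ∂(volume.restrict (Ioo (0 : ℝ) 1)) = ∫ x, x ∂μ := by
  conv_rhs => rw [← map_realQuantile (μ := μ)]
  exact (integral_map measurable_realQuantile.aemeasurable aestronglyMeasurable_id).symm

theorem realQuantile_map_sub_const (m : ℝ) {s : ℝ} (hs : s ∈ Ioo (0 : ℝ) 1) :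
    realQuantile (μ.map fun x => x - m) s = realQuantile μ s - m := by
  have hmeas : Measurable fun x : ℝ => x - m := by fun_prop
  have : IsProbabilityMeasure (μ.map fun x => x - m) :=
    Measure.isProbabilityMeasure_map hmeas.aemeasurable
  refine eq_of_forall_ge_iff fun x => ?_
  rw [realQuantile_le_iff hs, sub_le_iff_le_add, realQuantile_le_iff hs, cdf_eq_real, cdf_eq_real,
    map_measureReal_apply hmeas measurableSet_Iic]
  have : (fun x => x - m) ⁻¹' Iic x = Iic (x + m) := by
    ext y
    simp
  rw [this]

/-- Expanding (g(s) - g(1/2))(φ(s) - φ(1/2)) ≥ 0 bounds gφ below by an integrable combination of g,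
φ and a constant. Hence ∞ - ∞ never occurs in the integrals of a quantile function against φ. -/
theorem lintegral_neg_mul_ne_top_of_monotoneOn {g φ : ℝ → ℝ} (hg : MonotoneOn g (Ioo 0 1))
    (hφ : MonotoneOn φ (Ioo 0 1)) (hgi : IntegrableOn g (Ioo 0 1))
    (hφi : IntegrableOn φ (Ioo 0 1)) :
    ∫⁻ s in Ioo 0 1, ENNReal.ofReal (-(g s * φ s)) ≠ ∞ := by
  have hmid : (1 / 2 : ℝ) ∈ Ioo (0 : ℝ) 1 := ⟨by norm_num, by norm_num⟩
  refine lintegral_neg_ne_top_of_le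
    (g := fun s => g s * φ (1 / 2) + g (1 / 2) * φ s - g (1 / 2) * φ (1 / 2))
    (((hgi.mul_const _).add (hφi.const_mul _)).sub (integrable_const _)) ?_
  filter_upwards [ae_restrict_mem measurableSet_Ioo] with s hs
  rcases le_total s (1 / 2) with h | h
  · nlinarith [mul_nonneg (sub_nonneg.mpr (hg hs hmid h)) (sub_nonneg.mpr (hφ hs hmid h))]
  · nlinarith [mul_nonneg (sub_nonneg.mpr (hg hmid hs h)) (sub_nonneg.mpr (hφ hmid hs h))]

theorem distortion_eq_extIntegral {h : ℝ → ℝ} (hconv : ConvexOn ℝ (Icc 0 1) h)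
    (hcont : ContinuousOn h (Icc 0 1)) :
    distortion h μ = extIntegral (volume.restrict (Ioo (0 : ℝ) 1))
      (fun s => realQuantile μ s * leftDeriv h s) := by
  obtain ⟨hpos, hneg⟩ := toJordanDecomposition_stieltjes hconv hcont
  have hm : AEMeasurable (leftDeriv h) (volume.restrict (Ioo (0 : ℝ) 1)) :=
    (integrableOn_leftDeriv hconv hcont).aemeasurable
  have hq : Measurable (quantile μ) := quantile_monotone.measurable
  have key : ∀ (u : ℝ → EReal) (v w : ℝ → ℝ), Measurable u →
      AEMeasurable w (volume.restrict (Ioo (0 : ℝ) 1)) → (∀ s ∈ Ioo (0 : ℝ) 1, u s = v s) →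
      ∫⁻ s, (u s).toENNReal ∂((volume.restrict (Ioo (0 : ℝ) 1)).withDensity
        fun s => ENNReal.ofReal (w s)) =
      ∫⁻ s in Ioo 0 1, ENNReal.ofReal (w s) * ENNReal.ofReal (v s) := by
    intro u v w hu hw huv
    rw [lintegral_withDensity_eq_lintegral_mul₀ hw.ennreal_ofReal
      hu.ereal_toENNReal.aemeasurable]
    refine setLIntegral_congr_fun measurableSet_Ioo fun s hs => ?_
    simp [huv s hs]
  -- This is (ab)⁺ = a⁺b⁺ + a⁻b⁻; replacing a by -a gives the negative part.
  have hsplit : ∀ a b : ℝ, ENNReal.ofReal b * ENNReal.ofReal a +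
      ENNReal.ofReal (-b) * ENNReal.ofReal (-a) = ENNReal.ofReal (a * b) := by
    intro a b
    rcases le_total 0 a with ha | ha
    · rw [ENNReal.ofReal_of_nonpos (neg_nonpos.mpr ha), mul_zero, add_zero, mul_comm,
        ENNReal.ofReal_mul ha]
    · rw [ENNReal.ofReal_of_nonpos ha, mul_zero, zero_add, mul_comm,
        ← ENNReal.ofReal_mul (neg_nonneg.mpr ha), neg_mul_neg]
  have hg : Measurable (realQuantile μ) := measurable_realQuantile
  have hadd : ∀ {v w : ℝ → ℝ}, Measurable v →
      (∫⁻ s in Ioo 0 1, ENNReal.ofReal (leftDeriv h s) * ENNReal.ofReal (v s)) +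
        ∫⁻ s in Ioo 0 1, ENNReal.ofReal (-leftDeriv h s) * ENNReal.ofReal (w s) =
      ∫⁻ s in Ioo 0 1, (ENNReal.ofReal (leftDeriv h s) * ENNReal.ofReal (v s) +
        ENNReal.ofReal (-leftDeriv h s) * ENNReal.ofReal (w s)) := fun hv =>
    (lintegral_add_left' (hm.ennreal_ofReal.mul hv.ennreal_ofReal.aemeasurable) _).symm
  rw [distortion, extIntegral, hpos, hneg,
    key (quantile μ) (realQuantile μ) _ hq hm fun s hs => (coe_realQuantile hs).symm,
    key (fun s => -quantile μ s) (fun s => -realQuantile μ s) (fun s => -leftDeriv h s)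
      hq.neg hm.neg
      fun s hs => by rw [EReal.coe_neg, coe_realQuantile hs],
    key (fun s => -quantile μ s) (fun s => -realQuantile μ s) _ hq.neg hm
      fun s hs => by rw [EReal.coe_neg, coe_realQuantile hs],
    key (quantile μ) (realQuantile μ) (fun s => -leftDeriv h s) hq hm.neg
      fun s hs => (coe_realQuantile hs).symm,
    hadd hg, hadd (v := fun s => -realQuantile μ s) hg.neg]
  congr 3
  · exact funext fun s => hsplit _ _
  · refine funext fun s => ?_
    have := hsplit (-realQuantile μ s) (leftDeriv h s)
    rwa [neg_neg, neg_mul] at this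

end Quantile

/-! ### Coupling a random variable with a uniform variable that generates it -/

theorem map_prodMap_compProd_comap {Ω E F : Type*} [MeasurableSpace Ω] [MeasurableSpace E]
    [MeasurableSpace F] (P : Measure Ω) [IsFiniteMeasure P] {Z : Ω → E} (hZ : Measurable Z)
    (κ : Kernel E F) [IsMarkovKernel κ] :
    (P ⊗ₘ κ.comap Z hZ).map (Prod.map Z id) = P.map Z ⊗ₘ κ := by
  have hm : Measurable (Prod.map Z (id : F → F)) := hZ.prodMap measurable_id
  ext s hs
  rw [Measure.map_apply hm hs, Measure.compProd_apply (hm hs), Measure.compProd_apply hs,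
    lintegral_map (Kernel.measurable_kernel_prodMk_left hs) hZ]
  rfl

/-- Disintegrate the law of (g(U), U) over its first coordinate, which has the law of Z, and draw U
from the conditional law given Z(ω). The kernel supplies the randomisation needed at atoms of Z. -/
theorem exists_uniform_realQuantile {Ω : Type*} [MeasurableSpace Ω] (P : Measure Ω)
    [IsProbabilityMeasure P] {Z : Ω → ℝ} (hZ : Measurable Z) :
    ∃ Q : Measure (Ω × ℝ), Q.map Prod.fst = P ∧
      Q.map Prod.snd = volume.restrict (Ioo (0 : ℝ) 1) ∧
      ∀ᵐ x ∂Q, Z x.1 = realQuantile (P.map Z) x.2 := by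
  have : IsProbabilityMeasure (P.map Z) := Measure.isProbabilityMeasure_map hZ.aemeasurable
  set g := realQuantile (P.map Z) with hg
  have hgm : Measurable g := measurable_realQuantile
  have hpair : Measurable fun s : ℝ => (g s, s) := hgm.prodMk measurable_id
  set ρ : Measure (ℝ × ℝ) := (volume.restrict (Ioo (0 : ℝ) 1)).map fun s => (g s, s) with hρ
  have : IsProbabilityMeasure ρ := Measure.isProbabilityMeasure_map hpair.aemeasurable
  have hfst : ρ.fst = P.map Z := by
    rw [Measure.fst, hρ, Measure.map_map measurable_fst hpair]
    exact map_realQuantile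
  set Q := P ⊗ₘ ρ.condKernel.comap Z hZ with hQ
  have hm : Measurable (Prod.map Z (id : ℝ → ℝ)) := hZ.prodMap measurable_id
  have hQρ : Q.map (Prod.map Z id) = ρ := by
    rw [hQ, map_prodMap_compProd_comap, ← hfst, ρ.disintegrate ρ.condKernel]
  refine ⟨Q, Measure.fst_compProd _ _, ?_, ?_⟩
  · have : (Q.map (Prod.map Z id)).map Prod.snd = Q.map Prod.snd := by
      rw [Measure.map_map measurable_snd hm]
      rfl
    rw [← this, hQρ, hρ, Measure.map_map measurable_snd hpair]
    exact Measure.map_id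
  · have h1 : ∀ᵐ y ∂ρ, y.1 = g y.2 := by
      rw [hρ, ae_map_iff (p := fun y : ℝ × ℝ => y.1 = g y.2) hpair.aemeasurable
        (measurableSet_eq_fun measurable_fst (hgm.comp measurable_snd))]
      exact ae_of_all _ fun s => rfl
    rw [← hQρ] at h1
    exact ae_of_ae_map hm.aemeasurable h1

/-! ### The Hardy-Littlewood inequality -/

/-- The primitive of φ ∘ `cdf` is convex, and φ(s) is a subgradient of it at the s-quantile: `cdf`
is at least s to the right of that point and below s to the left. -/
theorem mul_le_primitive_cdf {μ : Measure ℝ} [IsProbabilityMeasure μ] {φ : ℝ → ℝ}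
    (hφ : Monotone φ) {s : ℝ} (hs : s ∈ Ioo (0 : ℝ) 1) (x : ℝ) :
    (x - realQuantile μ s) * φ s ≤
      (∫ t in (0 : ℝ)..x, φ (cdf μ t)) - ∫ t in (0 : ℝ)..(realQuantile μ s), φ (cdf μ t) := by
  have hmono : Monotone fun t => φ (cdf μ t) := hφ.comp (monotone_cdf μ)
  have hint : ∀ a b, IntervalIntegrable (fun t => φ (cdf μ t)) volume a b := fun a b =>
    hmono.intervalIntegrable
  set y := realQuantile μ s with hy
  rw [intervalIntegral.integral_interval_sub_left (hint _ _) (hint _ _)]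
  have hconst : ∀ a b : ℝ, (b - a) * φ s = ∫ _ in a..b, φ s := fun a b => by simp
  rcases le_total y x with h | h
  · rw [hconst]
    refine intervalIntegral.integral_mono_on h (by simp) (hint _ _) fun t ht => hφ ?_
    exact (realQuantile_le_iff hs t).mp ht.1
  · rw [intervalIntegral.integral_symm, ← neg_sub, neg_mul, neg_le_neg_iff, hconst]
    refine intervalIntegral.integral_mono_on_of_le_Ioo h (hint _ _) (by simp) fun t ht => hφ ?_
    exact (not_le.mp fun hle => absurd ((realQuantile_le_iff hs t).mpr hle)
      (not_le.mpr ht.2)).le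

variable {Ω : Type*} [MeasurableSpace Ω] {Q : Measure Ω} {Z U : Ω → ℝ}

theorem integrable_mul_comp_of_abs_le {f : Ω → ℝ} {φ : ℝ → ℝ} {C : ℝ} (hf : Integrable f Q)
    (hU : AEMeasurable U Q) (hφ : Measurable φ) (hC : ∀ s, |φ s| ≤ C) :
    Integrable (fun ω => f ω * φ (U ω)) Q :=
  hf.mul_bdd (c := C) (hφ.comp_aemeasurable hU).aestronglyMeasurable
    (ae_of_all _ fun ω => hC (U ω))

/-- Integrate the subgradient inequality at x = Z, s = U. The primitive `a` contributes a(Z) -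
a(g(U)), of mean zero because Z and g(U) have the same law; boundedness of φ gives `a` linear
growth, hence integrability. -/
theorem integral_mul_le_of_monotone_of_bounded [IsProbabilityMeasure Q] (hZ : Integrable Z Q)
    (hU : AEMeasurable U Q) (hUmap : Q.map U = volume.restrict (Ioo (0 : ℝ) 1))
    {φ : ℝ → ℝ} (hφ : Monotone φ) {C : ℝ} (hC : ∀ s, |φ s| ≤ C) :
    ∫ ω, Z ω * φ (U ω) ∂Q ≤ ∫ s in Ioo 0 1, realQuantile (Q.map Z) s * φ s := by
  have hZm : AEMeasurable Z Q := hZ.aemeasurable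
  have : IsProbabilityMeasure (Q.map Z) := Measure.isProbabilityMeasure_map hZm
  set μ := Q.map Z with hμ
  have hμi : Integrable id μ := (integrable_map_measure aestronglyMeasurable_id hZm).mpr hZ
  have hgi : Integrable (realQuantile μ) (volume.restrict (Ioo (0 : ℝ) 1)) :=
    integrable_realQuantile hμi
  set a : ℝ → ℝ := fun x => ∫ t in (0 : ℝ)..x, φ (cdf μ t) with ha
  have hmono : Monotone fun t => φ (cdf μ t) := hφ.comp (monotone_cdf μ)
  have hac : Continuous a :=
    intervalIntegral.continuous_primitive (fun _ _ => hmono.intervalIntegrable) 0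
  have hai : Integrable a μ := by
    refine (hμi.norm.const_mul C).mono' hac.aestronglyMeasurable (ae_of_all _ fun x => ?_)
    have := intervalIntegral.norm_integral_le_of_norm_le_const (a := 0) (b := x)
      (f := fun t => φ (cdf μ t)) (C := C) fun t _ => hC _
    simpa using this
  have haZ : Integrable (fun ω => a (Z ω)) Q := (integrable_map_measure
    hac.aestronglyMeasurable hZm).mp hai
  have hag : Integrable (fun s => a (realQuantile μ s)) (volume.restrict (Ioo (0 : ℝ) 1)) := by
    refine (integrable_map_measure hac.aestronglyMeasurable
      measurable_realQuantile.aemeasurable).mp ?_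
    rwa [map_realQuantile]
  have hgφ : Integrable (fun s => realQuantile μ s * φ s) (volume.restrict (Ioo (0 : ℝ) 1)) :=
    integrable_mul_comp_of_abs_le (U := id) hgi aemeasurable_id hφ.measurable hC
  have hW : Integrable (fun s => realQuantile μ s * φ s - a (realQuantile μ s)) (Q.map U) := by
    rw [hUmap]; exact hgφ.sub hag
  have hWU : Integrable
      (fun ω => realQuantile μ (U ω) * φ (U ω) - a (realQuantile μ (U ω))) Q :=
    hW.comp_aemeasurable hU
  have hle : ∀ᵐ ω ∂Q, Z ω * φ (U ω) ≤
      a (Z ω) + (realQuantile μ (U ω) * φ (U ω) - a (realQuantile μ (U ω))) := by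
    have hmem : ∀ᵐ ω ∂Q, U ω ∈ Ioo (0 : ℝ) 1 :=
      ae_of_ae_map hU (by rw [hUmap]; exact ae_restrict_mem measurableSet_Ioo)
    filter_upwards [hmem] with ω hω
    have := mul_le_primitive_cdf (μ := μ) hφ hω (Z ω)
    simp only [ha]
    linarith
  calc ∫ ω, Z ω * φ (U ω) ∂Q
      ≤ ∫ ω, (a (Z ω) + (realQuantile μ (U ω) * φ (U ω) - a (realQuantile μ (U ω)))) ∂Q :=
        integral_mono_ae (integrable_mul_comp_of_abs_le hZ hU hφ.measurable hC)
          (haZ.add hWU) hle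
    _ = (∫ x, a x ∂μ) + ∫ s, (realQuantile μ s * φ s - a (realQuantile μ s)) ∂(Q.map U) := by
        rw [integral_add haZ hWU, integral_map hZm hac.aestronglyMeasurable,
          integral_map hU hW.aestronglyMeasurable]
    _ = _ := by
        rw [hUmap, integral_sub hgφ hag, ← integral_map (φ := realQuantile μ) (f := a)
          measurable_realQuantile.aemeasurable hac.aestronglyMeasurable, map_realQuantile]
        ring

/-! ### Truncation of functions on the unit interval -/

/-- The truncation of `φ` on `(0, 1)` at the levels `-k` and `k`, extended to a function on `ℝ`
that is monotone if `φ` is. -/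
noncomputable def truncate (φ : ℝ → ℝ) (k : ℕ) (s : ℝ) : ℝ :=
  if s ≤ 0 then -k else if 1 ≤ s then k else max (-k) (min k (φ s))

section Truncate

variable {φ : ℝ → ℝ} {k : ℕ} {s : ℝ}

theorem truncate_of_mem (hs : s ∈ Ioo (0 : ℝ) 1) :
    truncate φ k s = max (-k : ℝ) (min k (φ s)) := by
  rw [truncate, if_neg (not_le.mpr hs.1), if_neg (not_le.mpr hs.2)]

theorem abs_truncate_le (s : ℝ) : |truncate φ k s| ≤ k := by
  have hk : (0 : ℝ) ≤ k := k.cast_nonneg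
  unfold truncate
  rw [abs_le]
  split_ifs
  · exact ⟨le_rfl, by linarith⟩
  · exact ⟨by linarith, le_rfl⟩
  · exact ⟨le_max_left _ _, max_le (by linarith) (min_le_left _ _)⟩

theorem monotone_truncate (hφ : MonotoneOn φ (Ioo 0 1)) : Monotone (truncate φ k) := by
  intro s t hst
  by_cases hs0 : s ≤ 0
  · rw [truncate, if_pos hs0]
    exact (abs_le.mp (abs_truncate_le t)).1
  by_cases ht1 : 1 ≤ t
  · rw [show truncate φ k t = k by
      rw [truncate, if_neg (by linarith), if_pos ht1]]
    exact (abs_le.mp (abs_truncate_le s)).2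
  push Not at hs0 ht1
  have hs : s ∈ Ioo (0 : ℝ) 1 := ⟨hs0, hst.trans_lt ht1⟩
  have ht : t ∈ Ioo (0 : ℝ) 1 := ⟨hs0.trans_le hst, ht1⟩
  rw [truncate_of_mem hs, truncate_of_mem ht]
  exact max_le_max le_rfl (min_le_min le_rfl (hφ hs ht hst))

/-- Truncation moves φ(s) towards 0 without changing its sign. This yields both the dominating
functions and the lower bound for Fatou's lemma. -/
theorem truncate_cases (hs : s ∈ Ioo (0 : ℝ) 1) :
    (0 ≤ truncate φ k s ∧ truncate φ k s ≤ φ s) ∨ (truncate φ k s ≤ 0 ∧ φ s ≤ truncate φ k s) := by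
  have hk : (0 : ℝ) ≤ k := k.cast_nonneg
  rw [truncate_of_mem hs]
  rcases le_total 0 (φ s) with h | h
  · left
    rw [max_eq_right (by linarith [le_min hk h])]
    exact ⟨le_min hk h, min_le_right _ _⟩
  · right
    rw [min_eq_right (h.trans hk)]
    exact ⟨max_le (by linarith) h, le_max_right _ _⟩

theorem abs_truncate_le_abs (hs : s ∈ Ioo (0 : ℝ) 1) : |truncate φ k s| ≤ |φ s| := by
  rcases truncate_cases (φ := φ) (k := k) hs with h | h
  · rw [abs_of_nonneg h.1, abs_of_nonneg (h.1.trans h.2)]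
    exact h.2
  · rw [abs_of_nonpos h.1, abs_of_nonpos (h.2.trans h.1)]
    exact neg_le_neg h.2

theorem tendsto_truncate (hs : s ∈ Ioo (0 : ℝ) 1) :
    Tendsto (fun k : ℕ => truncate φ k s) atTop (𝓝 (φ s)) := by
  refine tendsto_const_nhds.congr' ?_
  obtain ⟨K, hK⟩ := exists_nat_ge |φ s|
  filter_upwards [eventually_ge_atTop K] with k hk
  have : |φ s| ≤ k := hK.trans (Nat.cast_le.mpr hk)
  rw [truncate_of_mem hs, min_eq_right (abs_le.mp this).2, max_eq_right (abs_le.mp this).1]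

end Truncate

/-- The **Hardy-Littlewood inequality**: comonotone arrangements maximize the expectation of a
product. -/
theorem integral_mul_le_of_monotoneOn [IsProbabilityMeasure Q] (hZ : Integrable Z Q)
    (hU : AEMeasurable U Q) (hUmap : Q.map U = volume.restrict (Ioo (0 : ℝ) 1))
    {φ : ℝ → ℝ} (hφ : MonotoneOn φ (Ioo 0 1)) (hZφ : Integrable (fun ω => Z ω * φ (U ω)) Q)
    (hgφ : IntegrableOn (fun s => realQuantile (Q.map Z) s * φ s) (Ioo 0 1)) :
    ∫ ω, Z ω * φ (U ω) ∂Q ≤ ∫ s in Ioo 0 1, realQuantile (Q.map Z) s * φ s := by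
  have hmem : ∀ᵐ ω ∂Q, U ω ∈ Ioo (0 : ℝ) 1 :=
    ae_of_ae_map hU (by rw [hUmap]; exact ae_restrict_mem measurableSet_Ioo)
  have hmt : ∀ k, Measurable (truncate φ k) := fun k => (monotone_truncate hφ).measurable
  have h1 : Tendsto (fun k : ℕ => ∫ ω, Z ω * truncate φ k (U ω) ∂Q) atTop
      (𝓝 (∫ ω, Z ω * φ (U ω) ∂Q)) := by
    refine tendsto_integral_of_dominated_convergence (fun ω => ‖Z ω * φ (U ω)‖)
      (fun k => hZ.aestronglyMeasurable.mul
        ((hmt k).comp_aemeasurable hU).aestronglyMeasurable) hZφ.norm (fun k => ?_) ?_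
    · filter_upwards [hmem] with ω hω
      rw [norm_mul, norm_mul]
      exact mul_le_mul_of_nonneg_left (abs_truncate_le_abs hω) (norm_nonneg _)
    · filter_upwards [hmem] with ω hω
      exact (tendsto_truncate hω).const_mul _
  have h2 : Tendsto (fun k : ℕ => ∫ s in Ioo 0 1, realQuantile (Q.map Z) s * truncate φ k s) atTop
      (𝓝 (∫ s in Ioo 0 1, realQuantile (Q.map Z) s * φ s)) := by
    refine tendsto_integral_of_dominated_convergence
      (fun s => ‖realQuantile (Q.map Z) s * φ s‖)
      (fun k => (measurable_realQuantile.mul (hmt k)).aestronglyMeasurable) hgφ.norm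
      (fun k => ?_) ?_
    · filter_upwards [ae_restrict_mem measurableSet_Ioo] with s hs
      rw [norm_mul, norm_mul]
      exact mul_le_mul_of_nonneg_left (abs_truncate_le_abs hs) (norm_nonneg _)
    · filter_upwards [ae_restrict_mem measurableSet_Ioo] with s hs
      exact (tendsto_truncate hs).const_mul _
  exact le_of_tendsto_of_tendsto' h1 h2 fun k =>
    integral_mul_le_of_monotone_of_bounded hZ hU hUmap (monotone_truncate hφ) abs_truncate_le

/-! ### Upper bounds -/

/-- Fatou's lemma for the nonnegative functions f k + m. -/
theorem integral_le_of_tendsto_of_le {α : Type*} [MeasurableSpace α] {ν : Measure α}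
    {f : ℕ → α → ℝ} {g m : α → ℝ} {R : ℕ → ℝ} {r : ℝ} (hf : ∀ k, Integrable (f k) ν)
    (hg : AEMeasurable g ν) (hm : Integrable m ν) (hmf : ∀ k, ∀ᵐ x ∂ν, -m x ≤ f k x)
    (hlim : ∀ᵐ x ∂ν, Tendsto (fun k => f k x) atTop (𝓝 (g x)))
    (hR : ∀ k, ∫ x, f k x ∂ν ≤ R k) (hr : Tendsto R atTop (𝓝 r)) :
    Integrable g ν ∧ ∫ x, g x ∂ν ≤ r := by
  have hmg : ∀ᵐ x ∂ν, 0 ≤ g x + m x := by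
    filter_upwards [hlim, ae_all_iff.mpr hmf] with x hx hx2
    have : -m x ≤ g x := ge_of_tendsto' hx hx2
    linarith
  have hint : ∀ k, ∫⁻ x, ENNReal.ofReal (f k x + m x) ∂ν ≤
      ENNReal.ofReal (R k + ∫ x, m x ∂ν) := fun k => by
    rw [← ofReal_integral_eq_lintegral_ofReal (f := fun x => f k x + m x) ((hf k).add hm)
      (by filter_upwards [hmf k] with x hx; simp only [Pi.zero_apply]; linarith),
      integral_add (hf k) hm]
    exact ENNReal.ofReal_le_ofReal (by linarith [hR k])
  have hfatou : ∫⁻ x, ENNReal.ofReal (g x + m x) ∂ν ≤ ENNReal.ofReal (r + ∫ x, m x ∂ν) := by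
    calc ∫⁻ x, ENNReal.ofReal (g x + m x) ∂ν
        = ∫⁻ x, liminf (fun k => ENNReal.ofReal (f k x + m x)) atTop ∂ν := by
          refine lintegral_congr_ae ?_
          filter_upwards [hlim] with x hx
          exact (((ENNReal.continuous_ofReal.tendsto _).comp
            (hx.add_const (m x))).liminf_eq).symm
      _ ≤ liminf (fun k => ∫⁻ x, ENNReal.ofReal (f k x + m x) ∂ν) atTop :=
          lintegral_liminf_le' fun k => ((hf k).aemeasurable.add hm.aemeasurable).ennreal_ofReal
      _ ≤ liminf (fun k => ENNReal.ofReal (R k + ∫ x, m x ∂ν)) atTop :=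
          liminf_le_liminf (Eventually.of_forall hint)
      _ = _ := ((ENNReal.continuous_ofReal.tendsto _).comp (hr.add_const _)).liminf_eq
  have hgm : Integrable (fun x => g x + m x) ν := by
    refine ⟨(hg.add hm.aemeasurable).aestronglyMeasurable, ?_⟩
    rw [hasFiniteIntegral_iff_ofReal hmg]
    exact hfatou.trans_lt ENNReal.ofReal_lt_top
  have hgi : Integrable g ν := (hgm.sub hm).congr (ae_of_all _ fun x => by simp)
  refine ⟨hgi, ?_⟩
  -- `ENNReal.ofReal` sends negative numbers to 0, so the Fatou bound becomes a real inequality only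
  -- once its right side is known to be nonnegative.
  have hpos : 0 ≤ r + ∫ x, m x ∂ν := by
    refine ge_of_tendsto' (hr.add_const _) fun k => ?_
    have h0 : 0 ≤ ∫ x, (f k x + m x) ∂ν := integral_nonneg_of_ae (by
      filter_upwards [hmf k] with x hx
      simp only [Pi.zero_apply]; linarith)
    rw [integral_add (hf k) hm] at h0
    linarith [hR k]
  rw [← ofReal_integral_eq_lintegral_ofReal hgm hmg, ENNReal.ofReal_le_ofReal_iff hpos,
    integral_add hgi hm] at hfatou
  linarith

/-- With U chosen so that Z₁ = g₁(U), the first integral equals E[Z₁ φ(U)], while Hardy–Littlewood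
bounds the second below by E[Z₂ φ(U)]. Hölder's inequality applies to the difference. -/
theorem ofReal_integral_realQuantile_sub_le {Ω : Type*} [MeasurableSpace Ω] {P : Measure Ω}
    [IsProbabilityMeasure P] {Z₁ Z₂ : Ω → ℝ} (hm₁ : Measurable Z₁) (hm₂ : Measurable Z₂)
    (hi₁ : Integrable Z₁ P) (hi₂ : Integrable Z₂ P) {p q : ℝ≥0∞} [p.HolderConjugate q]
    {φ : ℝ → ℝ} (hφ : Monotone φ) {C : ℝ} (hC : ∀ s, |φ s| ≤ C) :
    ENNReal.ofReal ((∫ s in Ioo 0 1, realQuantile (P.map Z₁) s * φ s) -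
        ∫ s in Ioo 0 1, realQuantile (P.map Z₂) s * φ s) ≤
      eLpNorm (fun ω => Z₁ ω - Z₂ ω) p P * unitNorm q φ := by
  obtain ⟨Q, hQ1, hQ2, hQ⟩ := exists_uniform_realQuantile P hm₁
  have hfst : AEMeasurable (Prod.fst : Ω × ℝ → Ω) Q := measurable_fst.aemeasurable
  have hsnd : AEMeasurable (Prod.snd : Ω × ℝ → ℝ) Q := measurable_snd.aemeasurable
  have : IsProbabilityMeasure Q := by
    have : IsProbabilityMeasure (Q.map Prod.fst) := hQ1 ▸ inferInstance
    exact Measure.isProbabilityMeasure_of_map Prod.fst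
  have hI1 : Integrable (fun x : Ω × ℝ => Z₁ x.1) Q := by
    rw [← hQ1] at hi₁; exact hi₁.comp_aemeasurable hfst
  have hI2 : Integrable (fun x : Ω × ℝ => Z₂ x.1) Q := by
    rw [← hQ1] at hi₂; exact hi₂.comp_aemeasurable hfst
  have hmap2 : Q.map (fun x : Ω × ℝ => Z₂ x.1) = P.map Z₂ := by
    rw [← hQ1, Measure.map_map hm₂ measurable_fst]; rfl
  have h1 : ∫ s in Ioo 0 1, realQuantile (P.map Z₁) s * φ s = ∫ x, Z₁ x.1 * φ x.2 ∂Q := by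
    rw [← hQ2, integral_map (f := fun s => realQuantile (P.map Z₁) s * φ s) hsnd
      (measurable_realQuantile.mul hφ.measurable).aestronglyMeasurable]
    refine integral_congr_ae ?_
    filter_upwards [hQ] with x hx
    rw [hx]
  have h2 := integral_mul_le_of_monotone_of_bounded hI2 hsnd hQ2 hφ hC
  rw [hmap2] at h2
  have hi1φ : Integrable (fun x : Ω × ℝ => Z₁ x.1 * φ x.2) Q :=
    integrable_mul_comp_of_abs_le hI1 hsnd hφ.measurable hC
  have hi2φ : Integrable (fun x : Ω × ℝ => Z₂ x.1 * φ x.2) Q :=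
    integrable_mul_comp_of_abs_le hI2 hsnd hφ.measurable hC
  have hdm : Measurable fun x : Ω × ℝ => Z₁ x.1 - Z₂ x.1 := by fun_prop
  have hφm : Measurable fun x : Ω × ℝ => φ x.2 := hφ.measurable.comp measurable_snd
  calc ENNReal.ofReal ((∫ s in Ioo 0 1, realQuantile (P.map Z₁) s * φ s) -
        ∫ s in Ioo 0 1, realQuantile (P.map Z₂) s * φ s)
      ≤ ENNReal.ofReal (∫ x : Ω × ℝ, (Z₁ x.1 - Z₂ x.1) * φ x.2 ∂Q) := by
        refine ENNReal.ofReal_le_ofReal ?_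
        simp only [sub_mul]
        rw [integral_sub hi1φ hi2φ, h1]
        linarith
    _ ≤ ‖∫ x : Ω × ℝ, (Z₁ x.1 - Z₂ x.1) * φ x.2 ∂Q‖ₑ := by
        rw [Real.enorm_eq_ofReal_abs]
        exact ENNReal.ofReal_le_ofReal (le_abs_self _)
    _ ≤ ∫⁻ x : Ω × ℝ, ‖(Z₁ x.1 - Z₂ x.1) * φ x.2‖ₑ ∂Q := enorm_integral_le_lintegral_enorm _
    _ = eLpNorm (fun x : Ω × ℝ => (Z₁ x.1 - Z₂ x.1) * φ x.2) 1 Q :=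
        eLpNorm_one_eq_lintegral_enorm.symm
    _ ≤ (1 : NNReal) * eLpNorm (fun x : Ω × ℝ => Z₁ x.1 - Z₂ x.1) p Q *
          eLpNorm (fun x : Ω × ℝ => φ x.2) q Q :=
        eLpNorm_le_eLpNorm_mul_eLpNorm'_of_norm hdm.aestronglyMeasurable
          hφm.aestronglyMeasurable (fun a b => a * b) 1 (ae_of_all _ fun x => by simp)
    _ = eLpNorm (fun ω => Z₁ ω - Z₂ ω) p P * unitNorm q φ := by
        rw [ENNReal.coe_one, one_mul, unitNorm, ← hQ2, ← hQ1,
          eLpNorm_map_measure hφ.measurable.aestronglyMeasurable hsnd,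
          eLpNorm_map_measure (g := fun ω => Z₁ ω - Z₂ ω) (hm₁.sub hm₂).aestronglyMeasurable hfst]
        rfl

/-- Removes the truncation: dominated convergence on the μ₂ side, and Fatou on the μ₁ side, where
integrability is not known beforehand. -/
theorem extIntegral_realQuantile_mul_le {μ₁ μ₂ : Measure ℝ} [IsProbabilityMeasure μ₁]
    [IsProbabilityMeasure μ₂] (hμ₁ : Integrable id μ₁) (hμ₂ : Integrable id μ₂) {φ : ℝ → ℝ}
    (hφ : MonotoneOn φ (Ioo 0 1)) (hφi : IntegrableOn φ (Ioo 0 1)) {K : ℝ≥0∞}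
    (hK : ∀ k : ℕ, ENNReal.ofReal ((∫ s in Ioo 0 1, realQuantile μ₁ s * truncate φ k s) -
      ∫ s in Ioo 0 1, realQuantile μ₂ s * truncate φ k s) ≤ K) :
    extIntegral (volume.restrict (Ioo (0 : ℝ) 1)) (fun s => realQuantile μ₁ s * φ s) ≤
      extIntegral (volume.restrict (Ioo (0 : ℝ) 1)) (fun s => realQuantile μ₂ s * φ s) + K := by
  have hg₁ : IntegrableOn (realQuantile μ₁) (Ioo 0 1) := integrable_realQuantile hμ₁
  have hg₂ : IntegrableOn (realQuantile μ₂) (Ioo 0 1) := integrable_realQuantile hμ₂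
  have hφm : AEMeasurable φ (volume.restrict (Ioo (0 : ℝ) 1)) := hφi.aemeasurable
  have hneg₁ := lintegral_neg_mul_ne_top_of_monotoneOn (monotoneOn_realQuantile (μ := μ₁)) hφ
    hg₁ hφi
  have hneg₂ := lintegral_neg_mul_ne_top_of_monotoneOn (monotoneOn_realQuantile (μ := μ₂)) hφ
    hg₂ hφi
  by_cases hint : IntegrableOn (fun s => realQuantile μ₂ s * φ s) (Ioo 0 1)
  swap
  · rw [extIntegral_eq_top (f := fun s => realQuantile μ₂ s * φ s)
      (measurable_realQuantile.aemeasurable.mul hφm) hneg₂ hint,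
      EReal.top_add_of_ne_bot (EReal.coe_ennreal_ne_bot K)]
    exact le_top
  rw [extIntegral_eq_integral (f := fun s => realQuantile μ₂ s * φ s) hint]
  rcases eq_or_ne K ∞ with rfl | hKtop
  · rw [EReal.coe_ennreal_top, EReal.coe_add_top]
    exact le_top
  have hmt : ∀ k, Measurable (truncate φ k) := fun k => (monotone_truncate hφ).measurable
  have hmem : ∀ᵐ s ∂(volume.restrict (Ioo (0 : ℝ) 1)), s ∈ Ioo (0 : ℝ) 1 :=
    ae_restrict_mem measurableSet_Ioo
  have hlim : Tendsto (fun k : ℕ => ∫ s in Ioo 0 1, realQuantile μ₂ s * truncate φ k s) atTop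
      (𝓝 (∫ s in Ioo 0 1, realQuantile μ₂ s * φ s)) := by
    refine tendsto_integral_of_dominated_convergence (fun s => ‖realQuantile μ₂ s * φ s‖)
      (fun k => (measurable_realQuantile.mul (hmt k)).aestronglyMeasurable) hint.norm
      (fun k => ?_) ?_
    · filter_upwards [hmem] with s hs
      rw [norm_mul, norm_mul]
      exact mul_le_mul_of_nonneg_left (abs_truncate_le_abs hs) (norm_nonneg _)
    · filter_upwards [hmem] with s hs
      exact (tendsto_truncate hs).const_mul _
  have hm : Integrable (fun s => max (-(realQuantile μ₁ s * φ s)) 0)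
      (volume.restrict (Ioo (0 : ℝ) 1)) := by
    refine ⟨((measurable_realQuantile.aemeasurable.mul hφm).neg.max
      aemeasurable_const).aestronglyMeasurable, ?_⟩
    rw [hasFiniteIntegral_iff_ofReal (f := fun s => max (-(realQuantile μ₁ s * φ s)) 0)
      (ae_of_all _ fun s => le_max_right _ _)]
    refine lt_of_le_of_lt (lintegral_mono fun s => ?_) hneg₁.lt_top
    rcases le_total 0 (-(realQuantile μ₁ s * φ s)) with h | h
    · rw [max_eq_left h]
    · rw [max_eq_right h]; simp
  have key := integral_le_of_tendsto_of_le
    (f := fun k s => realQuantile μ₁ s * truncate φ k s) (g := fun s => realQuantile μ₁ s * φ s)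
    (fun k => integrable_mul_comp_of_abs_le (U := id) hg₁ aemeasurable_id (hmt k)
      abs_truncate_le) (measurable_realQuantile.aemeasurable.mul hφm) hm
    (fun k => by
      filter_upwards [hmem] with s hs
      rw [neg_le, le_max_iff]
      rcases truncate_cases (φ := φ) (k := k) hs with h | h <;>
        rcases le_total 0 (realQuantile μ₁ s) with h' | h'
      · right; nlinarith [mul_nonneg h' h.1]
      · left; nlinarith [mul_le_mul_of_nonpos_left h.2 h']
      · left; nlinarith [mul_le_mul_of_nonneg_left h.2 h']
      · right; nlinarith [mul_nonneg_of_nonpos_of_nonpos h' h.1])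
    (by filter_upwards [hmem] with s hs using (tendsto_truncate hs).const_mul _)
    (R := fun k => (∫ s in Ioo 0 1, realQuantile μ₂ s * truncate φ k s) + K.toReal)
    (fun k => by
      have := (ENNReal.ofReal_le_iff_le_toReal hKtop).mp (hK k)
      linarith)
    (hlim.add_const _)
  rw [extIntegral_eq_integral key.1, ← EReal.coe_ennreal_toReal hKtop, ← EReal.coe_add,
    EReal.coe_le_coe_iff]
  exact key.2

section Ball

variable {n : ℕ} {N : Seminorm ℝ (Fin n → ℝ)} {p q : ℝ≥0∞} {F₀ F : Measure (Fin n → ℝ)} {ε : ℝ}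

theorem extIntegral_le_of_mem_wassersteinBall [p.HolderConjugate q] (hF₀ : F₀ ∈ finiteMoment p)
    (hF : F ∈ wassersteinBall N p F₀ ε) {T : (Fin n → ℝ) → ℝ} (hT : Measurable T) {L : ℝ}
    (hL0 : 0 ≤ L) (hL : ∀ x y, |T x - T y| ≤ L * N (x - y)) (hT₀ : Integrable T F₀)
    (hT₁ : Integrable T F) {φ : ℝ → ℝ} (hφ : MonotoneOn φ (Ioo 0 1))
    (hφi : IntegrableOn φ (Ioo 0 1)) :
    extIntegral (volume.restrict (Ioo (0 : ℝ) 1)) (fun s => realQuantile (F.map T) s * φ s) ≤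
      extIntegral (volume.restrict (Ioo (0 : ℝ) 1)) (fun s => realQuantile (F₀.map T) s * φ s) +
        ((unitNorm q φ * ENNReal.ofReal (ε * L) : ℝ≥0∞) : EReal) := by
  have hp0 := hF₀.1
  have hp1 := hF.1.1
  have := Measure.isProbabilityMeasure_map (μ := F) hT.aemeasurable
  have := Measure.isProbabilityMeasure_map (μ := F₀) hT.aemeasurable
  refine extIntegral_realQuantile_mul_le
    ((integrable_map_measure aestronglyMeasurable_id hT.aemeasurable).mpr hT₁)
    ((integrable_map_measure aestronglyMeasurable_id hT.aemeasurable).mpr hT₀) hφ hφi fun k => ?_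
  set Δ := (∫ s in Ioo 0 1, realQuantile (F.map T) s * truncate φ k s) -
      ∫ s in Ioo 0 1, realQuantile (F₀.map T) s * truncate φ k s with hΔ
  set c := unitNorm q (truncate φ k) * ENNReal.ofReal L with hc
  -- Truncation keeps c finite even if ‖φ‖_q = ∞; the later division by c needs this.
  have hctop : c ≠ ∞ := by
    refine ENNReal.mul_ne_top ?_ ENNReal.ofReal_ne_top
    exact (MemLp.of_bound (monotone_truncate hφ).measurable.aestronglyMeasurable k
      (ae_of_all _ fun s => abs_truncate_le s)).eLpNorm_ne_top
  have hcoupling : ∀ π ∈ couplings F F₀, ENNReal.ofReal Δ ≤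
      eLpNorm (fun z : (Fin n → ℝ) × (Fin n → ℝ) => N (z.1 - z.2)) p π * c := by
    rintro π ⟨hπ1, hπ2⟩
    have : IsProbabilityMeasure π := by
      have : IsProbabilityMeasure (π.map Prod.fst) := hπ1 ▸ hp1
      exact Measure.isProbabilityMeasure_of_map Prod.fst
    have h1 : π.map (fun z : (Fin n → ℝ) × (Fin n → ℝ) => T z.1) = F.map T := by
      rw [← hπ1, Measure.map_map hT measurable_fst]; rfl
    have h2 : π.map (fun z : (Fin n → ℝ) × (Fin n → ℝ) => T z.2) = F₀.map T := by
      rw [← hπ2, Measure.map_map hT measurable_snd]; rfl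
    have hi1 : Integrable (fun z : (Fin n → ℝ) × (Fin n → ℝ) => T z.1) π := by
      rw [← hπ1] at hT₁; exact hT₁.comp_aemeasurable measurable_fst.aemeasurable
    have hi2 : Integrable (fun z : (Fin n → ℝ) × (Fin n → ℝ) => T z.2) π := by
      rw [← hπ2] at hT₀; exact hT₀.comp_aemeasurable measurable_snd.aemeasurable
    have key := ofReal_integral_realQuantile_sub_le (hT.comp measurable_fst)
      (hT.comp measurable_snd) hi1 hi2 (p := p) (q := q) (monotone_truncate (k := k) hφ)
      abs_truncate_le
    simp only [Function.comp_def] at key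
    rw [h1, h2] at key
    refine key.trans ?_
    have hle : eLpNorm (fun z : (Fin n → ℝ) × (Fin n → ℝ) => T z.1 - T z.2) p π ≤
        ENNReal.ofReal L * eLpNorm (fun z : (Fin n → ℝ) × (Fin n → ℝ) => N (z.1 - z.2)) p π := by
      refine eLpNorm_le_mul_eLpNorm_of_ae_le_mul (ae_of_all _ fun z => ?_) p
      rw [Real.norm_eq_abs, Real.norm_of_nonneg (apply_nonneg N _)]
      exact hL _ _
    calc _ ≤ ENNReal.ofReal L * eLpNorm
          (fun z : (Fin n → ℝ) × (Fin n → ℝ) => N (z.1 - z.2)) p π * unitNorm q (truncate φ k) := by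
          gcongr
      _ = _ := by rw [hc]; ring
  have hW : ENNReal.ofReal Δ ≤ ENNReal.ofReal ε * c := by
    -- For c = 0 one coupling suffices, and one exists because the infimum over no couplings would
    -- be ∞.
    rcases eq_or_ne c 0 with h0 | h0
    · have hne : (couplings F F₀).Nonempty := by
        by_contra hemp
        rw [Set.not_nonempty_iff_eq_empty] at hemp
        have := hF.2
        rw [wasserstein, hemp] at this
        simp at this
      obtain ⟨π, hπ⟩ := hne
      have := hcoupling π hπ
      rw [h0, mul_zero] at this ⊢
      exact this
    · rw [← ENNReal.div_le_iff h0 hctop]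
      refine le_trans (le_iInf₂ fun π hπ => ?_) hF.2
      rw [ENNReal.div_le_iff h0 hctop]
      exact hcoupling π hπ
  refine hW.trans ?_
  have hmono : unitNorm q (truncate φ k) ≤ unitNorm q φ := by
    refine eLpNorm_mono_ae ?_
    filter_upwards [ae_restrict_mem measurableSet_Ioo] with s hs using abs_truncate_le_abs hs
  rw [ENNReal.ofReal_mul' hL0, hc]
  calc _ ≤ ENNReal.ofReal ε * (unitNorm q φ * ENNReal.ofReal L) := by gcongr
    _ = _ := by ring

end Ball

/-! ### Duality of `L^p` and `L^q` with bounded test functions -/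

section Dual

variable {α : Type*} [MeasurableSpace α] {ν : Measure α} {φ : α → ℝ} {c : ℝ≥0∞}

/-- The witness is the normalised indicator of {|φ| > c}, a set of positive measure. -/
theorem exists_nonneg_dual_top [IsFiniteMeasure ν] (hφ : Measurable φ) (hφi : Integrable φ ν)
    (hc : c < eLpNorm φ ∞ ν) :
    ∃ v : α → ℝ, Measurable v ∧ (∃ C, ∀ x, |v x| ≤ C) ∧ (∀ x, 0 ≤ v x) ∧ eLpNorm v 1 ν ≤ 1 ∧
      c ≤ ENNReal.ofReal (∫ x, v x * |φ x| ∂ν) := by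
  set A := {x | c < ‖φ x‖ₑ} with hA
  have hAm : MeasurableSet A := measurableSet_lt measurable_const hφ.enorm
  have hA0 : ν A ≠ 0 := by
    intro h0
    refine absurd hc (not_lt.mpr ?_)
    rw [eLpNorm_exponent_top]
    refine essSup_le_of_ae_le c ?_
    have : ∀ᵐ x ∂ν, x ∉ A := measure_eq_zero_iff_ae_notMem.mp h0
    filter_upwards [this] with x hx using not_lt.mp hx
  set r := (ν A).toReal⁻¹ with hr
  have hr0 : 0 ≤ r := inv_nonneg.mpr ENNReal.toReal_nonneg
  have hrA : ENNReal.ofReal r = (ν A)⁻¹ := by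
    rw [hr, ENNReal.ofReal_inv_of_pos (ENNReal.toReal_pos hA0 (measure_ne_top ν A)),
      ENNReal.ofReal_toReal (measure_ne_top ν A)]
  have hvm : Measurable (A.indicator fun _ => r) := measurable_const.indicator hAm
  have hv0 : ∀ x, 0 ≤ A.indicator (fun _ => r) x := fun x => indicator_nonneg (fun _ _ => hr0) x
  have hvr : ∀ x, |A.indicator (fun _ => r) x| ≤ r := fun x => by
    rw [abs_of_nonneg (hv0 x)]
    exact indicator_le_self' (fun _ _ => hr0) x
  refine ⟨A.indicator fun _ => r, hvm, ⟨r, hvr⟩, hv0, ?_, ?_⟩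
  · rw [eLpNorm_one_eq_lintegral_enorm]
    calc ∫⁻ x, ‖A.indicator (fun _ => r) x‖ₑ ∂ν
        = ∫⁻ x, A.indicator (fun _ => (ν A)⁻¹) x ∂ν := lintegral_congr fun x => by
          by_cases hx : x ∈ A
          · simp [hx, ← hrA, Real.enorm_of_nonneg hr0]
          · simp [hx]
      _ ≤ 1 := by
          rw [lintegral_indicator_const hAm, ENNReal.inv_mul_cancel hA0 (measure_ne_top ν A)]
  · rw [ofReal_integral_eq_lintegral_ofReal
      (hφi.abs.bdd_mul hvm.aestronglyMeasurable (ae_of_all _ hvr))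
      (ae_of_all _ fun x => mul_nonneg (hv0 x) (abs_nonneg _))]
    calc c = ∫⁻ x, A.indicator (fun _ => (ν A)⁻¹ * c) x ∂ν := by
          rw [lintegral_indicator_const hAm, mul_right_comm,
            ENNReal.inv_mul_cancel hA0 (measure_ne_top ν A), one_mul]
      _ ≤ _ := lintegral_mono fun x => by
          by_cases hx : x ∈ A
          · simp only [hx, indicator_of_mem]
            rw [ENNReal.ofReal_mul hr0, hrA, ← Real.enorm_eq_ofReal_abs]
            exact mul_le_mul_right (le_of_lt hx) _
          · simp [hx]

/-- The witness is the Hölder extremiser |φ|^(q-1), normalised, with |φ| replaced by 0 where it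
exceeds k so that the witness is bounded; monotone convergence provides a suitable k. -/
theorem exists_nonneg_dual_of_one_lt [IsFiniteMeasure ν] (hφ : Measurable φ) {p q : ℝ≥0∞}
    (hpq : p.toReal.HolderConjugate q.toReal)
    (hc : c < eLpNorm φ q ν) :
    ∃ v : α → ℝ, Measurable v ∧ (∃ C, ∀ x, |v x| ≤ C) ∧ (∀ x, 0 ≤ v x) ∧ eLpNorm v p ν ≤ 1 ∧
      c ≤ ENNReal.ofReal (∫ x, v x * |φ x| ∂ν) := by
  set r := q.toReal with hr
  set t := p.toReal with ht
  have hr1 : 1 < r := hpq.symm.lt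
  have hr0 : 0 < r := hpq.symm.pos
  have ht0 : 0 < t := hpq.pos
  have hq0 : q ≠ 0 := fun h => by simp [hr, h] at hr0
  have hqt : q ≠ ∞ := fun h => by simp [hr, h] at hr0
  have hp0 : p ≠ 0 := fun h => by simp [ht, h] at ht0
  have hpt : p ≠ ∞ := fun h => by simp [ht, h] at ht0
  set u : ℕ → α → ℝ := fun k => {x | |φ x| ≤ k}.indicator fun x => |φ x| with hu
  have hset : ∀ k : ℕ, MeasurableSet {x | |φ x| ≤ k} := fun k =>
    measurableSet_le hφ.abs measurable_const
  have hum : ∀ k, Measurable (u k) := fun k => hφ.abs.indicator (hset k)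
  have hu0 : ∀ k x, 0 ≤ u k x := fun k x => indicator_nonneg (fun _ _ => abs_nonneg _) x
  have huk : ∀ k x, u k x ≤ k := fun k x => by
    by_cases hx : x ∈ {x | |φ x| ≤ k}
    · simp only [hu, indicator_of_mem hx]; exact hx
    · simp only [hu, indicator_of_notMem hx]; exact k.cast_nonneg
  have hlim : Tendsto (fun k => ∫⁻ x, ENNReal.ofReal (u k x ^ r) ∂ν) atTop
      (𝓝 (∫⁻ x, ENNReal.ofReal (|φ x| ^ r) ∂ν)) := by
    refine lintegral_tendsto_of_tendsto_of_monotone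
      (fun k => ((hum k).pow_const r).ennreal_ofReal.aemeasurable)
      (ae_of_all _ fun x i j hij => ?_) (ae_of_all _ fun x => ?_)
    · refine ENNReal.ofReal_le_ofReal (Real.rpow_le_rpow (hu0 i x) ?_ hr0.le)
      exact indicator_le_indicator_of_subset
        (fun y (hy : |φ y| ≤ i) => hy.trans (Nat.cast_le.mpr hij)) (fun y => abs_nonneg _) x
    · refine tendsto_const_nhds.congr' ?_
      obtain ⟨K, hK⟩ := exists_nat_ge |φ x|
      filter_upwards [eventually_ge_atTop K] with k hk
      have hx : x ∈ {x | |φ x| ≤ k} := hK.trans (Nat.cast_le.mpr hk)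
      simp only [hu, indicator_of_mem hx]
  have hnorm : eLpNorm φ q ν = (∫⁻ x, ENNReal.ofReal (|φ x| ^ r) ∂ν) ^ (1 / r) := by
    rw [eLpNorm_eq_lintegral_rpow_enorm_toReal hq0 hqt]
    congr 1
    refine lintegral_congr fun x => ?_
    rw [Real.enorm_eq_ofReal_abs, ENNReal.ofReal_rpow_of_nonneg (abs_nonneg _) hr0.le]
  have hcr : c ^ r < ∫⁻ x, ENNReal.ofReal (|φ x| ^ r) ∂ν := by
    rw [hnorm] at hc
    have := ENNReal.rpow_lt_rpow hc hr0
    rwa [← ENNReal.rpow_mul, one_div_mul_cancel hr0.ne', ENNReal.rpow_one] at this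
  obtain ⟨k, hk⟩ := (hlim.eventually (lt_mem_nhds hcr)).exists
  have hui : Integrable (fun x => u k x ^ r) ν := by
    refine Integrable.of_bound ((hum k).pow_const r).aestronglyMeasurable ((k : ℝ) ^ r)
      (ae_of_all _ fun x => ?_)
    rw [Real.norm_of_nonneg (Real.rpow_nonneg (hu0 k x) _)]
    exact Real.rpow_le_rpow (hu0 k x) (huk k x) hr0.le
  rw [← ofReal_integral_eq_lintegral_ofReal hui
    (ae_of_all _ fun x => Real.rpow_nonneg (hu0 k x) _)] at hk
  set J := ∫ x, u k x ^ r ∂ν with hJ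
  have hJ0 : 0 < J := by
    by_contra! h
    rw [ENNReal.ofReal_of_nonpos h] at hk
    exact not_lt_zero hk
  -- As (r - 1)t = r, this is the L^p norm of u^(r-1), and J / b = J^(1/r) is the L^q norm of u.
  set b := J ^ (1 / t) with hb
  have hb0 : 0 < b := Real.rpow_pos_of_pos hJ0 _
  have hbt : b ^ t = J := by
    rw [hb, ← Real.rpow_mul hJ0.le, one_div_mul_cancel ht0.ne', Real.rpow_one]
  have hv0 : ∀ x, 0 ≤ u k x ^ (r - 1) / b := fun x =>
    div_nonneg (Real.rpow_nonneg (hu0 k x) _) hb0.le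
  refine ⟨fun x => u k x ^ (r - 1) / b, ((hum k).pow_const _).div_const _,
    ⟨(k : ℝ) ^ (r - 1) / b, fun x => ?_⟩, hv0, ?_, ?_⟩
  · rw [abs_of_nonneg (hv0 x)]
    exact div_le_div_of_nonneg_right
      (Real.rpow_le_rpow (hu0 k x) (huk k x) (by linarith)) hb0.le
  · have hvt : ∀ x, ‖u k x ^ (r - 1) / b‖ₑ ^ t = ENNReal.ofReal (u k x ^ r / J) := fun x => by
      rw [Real.enorm_of_nonneg (hv0 x), ENNReal.ofReal_rpow_of_nonneg (hv0 x) ht0.le,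
        Real.div_rpow (Real.rpow_nonneg (hu0 k x) _) hb0.le, hbt, ← Real.rpow_mul (hu0 k x)]
      congr 3
      have := hpq.symm.sub_one_mul_conj
      linarith
    rw [eLpNorm_eq_lintegral_rpow_enorm_toReal hp0 hpt, lintegral_congr hvt,
      ← ofReal_integral_eq_lintegral_ofReal (hui.div_const J)
        (ae_of_all _ fun x => div_nonneg (Real.rpow_nonneg (hu0 k x) _) hJ0.le),
      integral_div, ← hJ, div_self hJ0.ne', ENNReal.ofReal_one, ENNReal.one_rpow]
  · have hvφ : ∀ x, u k x ^ (r - 1) / b * |φ x| = u k x ^ r / b := fun x => by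
      by_cases hx : x ∈ {x | |φ x| ≤ k}
      · have hux : u k x = |φ x| := by simp only [hu, indicator_of_mem hx]
        rw [hux, div_mul_eq_mul_div]
        congr 1
        rcases (abs_nonneg (φ x)).eq_or_lt with h0 | h0
        · rw [← h0, mul_zero, Real.zero_rpow hr0.ne']
        · rw [Real.rpow_sub_one h0.ne', div_mul_cancel₀ _ h0.ne']
      · have hux : u k x = 0 := by simp only [hu, indicator_of_notMem hx]
        rw [hux, Real.zero_rpow (by linarith), Real.zero_rpow hr0.ne']
        simp
    simp only [hvφ]
    rw [integral_div, ← hJ]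
    have hJb : J / b = J ^ (1 / r) := by
      rw [hb, div_eq_mul_inv, ← Real.rpow_neg hJ0.le]
      nth_rewrite 1 [← Real.rpow_one J]
      rw [← Real.rpow_add hJ0]
      congr 1
      have := hpq.inv_add_inv_eq_one
      rw [one_div, one_div]
      linarith
    rw [hJb, ← ENNReal.ofReal_rpow_of_pos hJ0]
    have := ENNReal.rpow_le_rpow hk.le (one_div_pos.mpr hr0).le
    rwa [← ENNReal.rpow_mul, mul_one_div_cancel hr0.ne', ENNReal.rpow_one] at this

theorem exists_nonneg_dual [IsProbabilityMeasure ν] (hφ : Measurable φ) (hφi : Integrable φ ν)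
    {p q : ℝ≥0∞} [hpq : p.HolderConjugate q] (hc : c < eLpNorm φ q ν) :
    ∃ v : α → ℝ, Measurable v ∧ (∃ C, ∀ x, |v x| ≤ C) ∧ (∀ x, 0 ≤ v x) ∧ eLpNorm v p ν ≤ 1 ∧
      c ≤ ENNReal.ofReal (∫ x, v x * |φ x| ∂ν) := by
  rcases eq_or_ne q ∞ with rfl | hq
  · have hp : p = 1 := by
      have := ENNReal.holderConjugate_iff.mp hpq
      simpa using this
    rw [hp]
    exact exists_nonneg_dual_top hφ hφi hc
  rcases eq_or_ne p ∞ with rfl | hp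
  · have hq1 : q = 1 := by
      have := ENNReal.holderConjugate_iff.mp hpq
      simpa using this
    refine ⟨fun _ => 1, measurable_const, ⟨1, by simp⟩, by simp, ?_, ?_⟩
    · refine eLpNormEssSup_le_of_ae_enorm_bound (ae_of_all _ fun x => by simp)
    · refine hc.le.trans ?_
      simp only [one_mul]
      rw [hq1, eLpNorm_one_eq_lintegral_enorm,
        ofReal_integral_eq_lintegral_ofReal hφi.abs (ae_of_all _ fun x => abs_nonneg _)]
      simp only [Real.enorm_eq_ofReal_abs, le_refl]
  · exact exists_nonneg_dual_of_one_lt hφ (ENNReal.HolderConjugate.toReal_of_ne_top hp hq) hc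

/-- For `c < ‖φ‖_q` there is a bounded function `w` in the unit ball of `L^p`, negative only where
`φ` is, whose pairing with `φ` is at least `c`. -/
theorem exists_dual [IsProbabilityMeasure ν] (hφi : Integrable φ ν)
    {p q : ℝ≥0∞} [p.HolderConjugate q] (hc : c < eLpNorm φ q ν) :
    ∃ w : α → ℝ, Measurable w ∧ (∃ C, ∀ x, |w x| ≤ C) ∧ (∀ᵐ x ∂ν, 0 ≤ w x ∨ φ x < 0) ∧
      eLpNorm w p ν ≤ 1 ∧ c ≤ ENNReal.ofReal (∫ x, w x * φ x ∂ν) := by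
  obtain ⟨f, hfm, hf⟩ := hφi.aemeasurable
  rw [eLpNorm_congr_ae hf] at hc
  obtain ⟨v, hvm, ⟨C, hC⟩, hv0, hv1, hvc⟩ := exists_nonneg_dual (p := p) hfm (hφi.congr hf) hc
  have hset : MeasurableSet {x | f x < 0} := measurableSet_lt hfm measurable_const
  classical
  set w : α → ℝ := {x | f x < 0}.piecewise (fun x => -v x) v with hw
  have hwabs : ∀ x, |w x| = |v x| := fun x => by
    by_cases hx : x ∈ {x | f x < 0}
    · rw [hw, piecewise_eq_of_mem _ _ _ hx, abs_neg]
    · rw [hw, piecewise_eq_of_notMem _ _ _ hx]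
  refine ⟨w, hvm.neg.piecewise hset hvm, ⟨C, fun x => (hwabs x).trans_le (hC x)⟩, ?_, ?_, ?_⟩
  · filter_upwards [hf] with x hx
    rw [hx]
    by_cases h : f x < 0
    · exact Or.inr h
    · left
      rw [hw, piecewise_eq_of_notMem _ _ _ (show x ∉ {x | f x < 0} from h)]
      exact hv0 x
  · rwa [eLpNorm_congr_norm_ae (g := v) (ae_of_all _ hwabs)]
  · refine hvc.trans_eq ?_
    congr 1
    refine integral_congr_ae ?_
    filter_upwards [hf] with x hx
    rw [hx]
    by_cases h : f x < 0
    · rw [hw, piecewise_eq_of_mem _ _ _ (show x ∈ {x | f x < 0} from h), abs_of_neg h]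
      ring
    · rw [hw, piecewise_eq_of_notMem _ _ _ (show x ∉ {x | f x < 0} from h),
        abs_of_nonneg (not_lt.mp h)]

end Dual

/-! ### Lower bounds -/

section Lower

variable {n : ℕ} {N : Seminorm ℝ (Fin n → ℝ)} {p q : ℝ≥0∞} {F₀ F : Measure (Fin n → ℝ)} {ε : ℝ}

theorem map_mem_wassersteinBall (hN : Continuous N) {Ω : Type*} [MeasurableSpace Ω]
    {Q : Measure Ω} [IsProbabilityMeasure Q] {X Y : Ω → Fin n → ℝ} (hX : Measurable X)
    (hY : Measurable Y) (hYmap : Q.map Y = F₀) (hXp : ∀ i, MemLp (fun ω => X ω i) p Q)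
    (hXY : eLpNorm (fun ω => N (X ω - Y ω)) p Q ≤ ENNReal.ofReal ε) :
    Q.map X ∈ wassersteinBall N p F₀ ε := by
  have hXYm : Measurable fun ω => (X ω, Y ω) := hX.prodMk hY
  refine ⟨⟨Measure.isProbabilityMeasure_map hX.aemeasurable, fun i => ?_⟩, ?_⟩
  · exact (memLp_map_measure_iff (measurable_pi_apply i).aestronglyMeasurable
      hX.aemeasurable).mpr (hXp i)
  · have hmem : (Q.map fun ω => (X ω, Y ω)) ∈ couplings (Q.map X) F₀ := by
      refine ⟨?_, ?_⟩
      · rw [Measure.map_map measurable_fst hXYm]; rfl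
      · rw [Measure.map_map measurable_snd hXYm]; exact hYmap
    refine le_trans (iInf₂_le _ hmem) ?_
    have hc : Continuous fun z : (Fin n → ℝ) × (Fin n → ℝ) => N (z.1 - z.2) :=
      hN.comp (continuous_fst.sub continuous_snd)
    rw [eLpNorm_map_measure hc.aestronglyMeasurable hXYm.aemeasurable]
    exact hXY

theorem self_mem_wassersteinBall (hN : Continuous N) (hF₀ : F₀ ∈ finiteMoment p) :
    F₀ ∈ wassersteinBall N p F₀ ε := by
  have := hF₀.1
  have h := map_mem_wassersteinBall (F₀ := F₀) (ε := ε) (p := p) hN (Q := F₀) (X := id) (Y := id)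
    measurable_id measurable_id Measure.map_id hF₀.2 (by simp)
  rwa [Measure.map_id] at h

/-- The witness is the law of ξ + σ(ξ) ε w(U) d, where T(ξ) = g(U); boundedness of w preserves the
moments. The factor σ lets the direction depend on the sign of β·x. The alternative in `hshift`
allows negative shifts only if φ is negative somewhere, since |β·x| grows exactly linearly only for
t ≥ 0. -/
theorem exists_mem_wassersteinBall_le_extIntegral (hN : Continuous N) (hε : 0 ≤ ε)
    (hF₀ : F₀ ∈ finiteMoment p) {T σ : (Fin n → ℝ) → ℝ} (hT : Measurable T) (hσ : Measurable σ)
    (hTi : ∀ F : Measure (Fin n → ℝ), F ∈ finiteMoment p → Integrable T F)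
    (hσ1 : ∀ x, |σ x| ≤ 1) {d : Fin n → ℝ} (hd : N d ≤ 1) {L : ℝ} {φ : ℝ → ℝ}
    (hshift : ∀ x t, (0 ≤ t ∨ ∃ s ∈ Ioo (0 : ℝ) 1, φ s < 0) →
      T (x + (σ x * t) • d) = T x + t * L)
    (hφ : MonotoneOn φ (Ioo 0 1)) (hφi : IntegrableOn φ (Ioo 0 1))
    (hint : IntegrableOn (fun s => realQuantile (F₀.map T) s * φ s) (Ioo 0 1)) {w : ℝ → ℝ}
    (hw : Measurable w) {C : ℝ} (hC : ∀ s, |w s| ≤ C)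
    (hwφ : ∀ᵐ s ∂(volume.restrict (Ioo (0 : ℝ) 1)), 0 ≤ w s ∨ φ s < 0)
    (hw1 : eLpNorm w p (volume.restrict (Ioo (0 : ℝ) 1)) ≤ 1) :
    ∃ F ∈ wassersteinBall N p F₀ ε,
      (((∫ s in Ioo 0 1, realQuantile (F₀.map T) s * φ s) +
        (∫ s in Ioo 0 1, w s * φ s) * (ε * L) : ℝ) : EReal) ≤
        extIntegral (volume.restrict (Ioo (0 : ℝ) 1))
          (fun s => realQuantile (F.map T) s * φ s) := by
  have := hF₀.1
  obtain ⟨Q, hQ1, hQ2, hQ⟩ := exists_uniform_realQuantile F₀ hT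
  have hfst : AEMeasurable (Prod.fst : (Fin n → ℝ) × ℝ → Fin n → ℝ) Q := measurable_fst.aemeasurable
  have hsnd : AEMeasurable (Prod.snd : (Fin n → ℝ) × ℝ → ℝ) Q := measurable_snd.aemeasurable
  have : IsProbabilityMeasure Q := by
    have : IsProbabilityMeasure (Q.map Prod.fst) := hQ1 ▸ inferInstance
    exact Measure.isProbabilityMeasure_of_map Prod.fst
  set X : (Fin n → ℝ) × ℝ → Fin n → ℝ := fun z => z.1 + (σ z.1 * (ε * w z.2)) • d with hX
  have hcoef : Measurable fun z : (Fin n → ℝ) × ℝ => σ z.1 * (ε * w z.2) := by fun_prop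
  have hXm : Measurable X := measurable_fst.add (hcoef.smul_const d)
  have hcoef_le : ∀ z : (Fin n → ℝ) × ℝ, |σ z.1 * (ε * w z.2)| ≤ ε * |w z.2| := fun z => by
    rw [abs_mul, abs_mul, abs_of_nonneg hε]
    exact mul_le_of_le_one_left (by positivity) (hσ1 _)
  have hball : Q.map X ∈ wassersteinBall N p F₀ ε := by
    refine map_mem_wassersteinBall hN hXm measurable_fst hQ1 (fun i => ?_) ?_
    · have h1 : MemLp (fun z : (Fin n → ℝ) × ℝ => z.1 i) p Q := by
        have := hF₀.2 i
        rw [← hQ1] at this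
        exact (memLp_map_measure_iff (measurable_pi_apply i).aestronglyMeasurable hfst).mp this
      have h2 : MemLp (fun z : (Fin n → ℝ) × ℝ => σ z.1 * (ε * w z.2) * d i) p Q := by
        refine MemLp.of_bound (hcoef.mul_const _).aestronglyMeasurable (ε * C * |d i|)
          (ae_of_all _ fun z => ?_)
        rw [norm_mul, Real.norm_eq_abs, Real.norm_eq_abs]
        have := (hcoef_le z).trans (mul_le_mul_of_nonneg_left (hC z.2) hε)
        gcongr
      exact h1.add h2
    · have hb : eLpNorm (fun z : (Fin n → ℝ) × ℝ => N (X z - z.1)) p Q ≤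
          ENNReal.ofReal ε * eLpNorm (fun z : (Fin n → ℝ) × ℝ => w z.2) p Q := by
        refine eLpNorm_le_mul_eLpNorm_of_ae_le_mul (ae_of_all _ fun z => ?_) p
        rw [Real.norm_of_nonneg (apply_nonneg N _), Real.norm_eq_abs, hX]
        simp only [add_sub_cancel_left]
        rw [map_smul_eq_mul, Real.norm_eq_abs]
        exact (mul_le_of_le_one_right (abs_nonneg _) hd).trans (hcoef_le z)
      have hw2 : eLpNorm (fun z : (Fin n → ℝ) × ℝ => w z.2) p Q ≤ 1 := by
        rw [← hQ2, eLpNorm_map_measure hw.aestronglyMeasurable hsnd] at hw1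
        exact hw1
      calc _ ≤ _ := hb
        _ ≤ ENNReal.ofReal ε * 1 := by gcongr
        _ = _ := mul_one _
  refine ⟨Q.map X, hball, ?_⟩
  have hprob := hball.1.1
  have hTX : Integrable (fun z => T (X z)) Q :=
    (hTi _ hball.1).comp_aemeasurable hXm.aemeasurable
  have hmapT : (Q.map X).map T = Q.map fun z => T (X z) := Measure.map_map hT hXm
  have hTXprob : IsProbabilityMeasure (Q.map fun z => T (X z)) :=
    Measure.isProbabilityMeasure_map (hT.comp hXm).aemeasurable
  have hmem : ∀ᵐ z ∂Q, z.2 ∈ Ioo (0 : ℝ) 1 :=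
    ae_of_ae_map hsnd (by rw [hQ2]; exact ae_restrict_mem measurableSet_Ioo)
  have hwφ' : ∀ᵐ z ∂Q, 0 ≤ w z.2 ∨ φ z.2 < 0 := ae_of_ae_map hsnd (by rw [hQ2]; exact hwφ)
  have hval : ∀ᵐ z ∂Q, T (X z) * φ z.2 =
      realQuantile (F₀.map T) z.2 * φ z.2 + w z.2 * φ z.2 * (ε * L) := by
    filter_upwards [hmem, hwφ', hQ] with z hz hzw hzq
    have ht : 0 ≤ ε * w z.2 ∨ ∃ s ∈ Ioo (0 : ℝ) 1, φ s < 0 :=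
      hzw.imp (fun h => mul_nonneg hε h) fun h => ⟨z.2, hz, h⟩
    rw [hX]
    simp only
    rw [hshift _ _ ht, hzq]
    ring
  have hwφi : Integrable (fun s => w s * φ s) (volume.restrict (Ioo (0 : ℝ) 1)) :=
    hφi.bdd_mul hw.aestronglyMeasurable (ae_of_all _ hC)
  have hsum : Integrable (fun s => realQuantile (F₀.map T) s * φ s + w s * φ s * (ε * L))
      (Q.map Prod.snd) := by
    rw [hQ2]; exact hint.add (hwφi.mul_const _)
  have hTXφ : Integrable (fun z => T (X z) * φ z.2) Q :=
    (hsum.comp_aemeasurable hsnd).congr (hval.mono fun z hz => hz.symm)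
  have hTXφ_eq : ∫ z, T (X z) * φ z.2 ∂Q =
      (∫ s in Ioo 0 1, realQuantile (F₀.map T) s * φ s) +
        (∫ s in Ioo 0 1, w s * φ s) * (ε * L) := by
    rw [integral_congr_ae hval, ← integral_map hsnd hsum.aestronglyMeasurable, hQ2,
      integral_add hint (hwφi.mul_const _), integral_mul_const]
  rw [hmapT]
  by_cases hstar : IntegrableOn (fun s => realQuantile (Q.map fun z => T (X z)) s * φ s) (Ioo 0 1)
  · rw [extIntegral_eq_integral
      (f := fun s => realQuantile (Q.map fun z => T (X z)) s * φ s) hstar, ← hTXφ_eq,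
      EReal.coe_le_coe_iff]
    exact integral_mul_le_of_monotoneOn hTX hsnd hQ2 hφ hTXφ hstar
  · have hgi : Integrable id (Q.map fun z => T (X z)) :=
      (integrable_map_measure aestronglyMeasurable_id (hT.comp hXm).aemeasurable).mpr hTX
    rw [extIntegral_eq_top (f := fun s => realQuantile (Q.map fun z => T (X z)) s * φ s)
      (measurable_realQuantile.aemeasurable.mul hφi.aemeasurable)
      (lintegral_neg_mul_ne_top_of_monotoneOn monotoneOn_realQuantile hφ
        (integrable_realQuantile hgi) hφi) hstar]
    exact le_top

theorem iSup_extIntegral_eq [p.HolderConjugate q] (hN : Continuous N) (hε : 0 ≤ ε)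
    (hF₀ : F₀ ∈ finiteMoment p) {T σ : (Fin n → ℝ) → ℝ} (hT : Measurable T) (hσ : Measurable σ)
    (hTi : ∀ F : Measure (Fin n → ℝ), F ∈ finiteMoment p → Integrable T F)
    (hσ1 : ∀ x, |σ x| ≤ 1) {d : Fin n → ℝ} (hd : N d ≤ 1) {L : ℝ} (hL0 : 0 ≤ L)
    (hL : ∀ x y, |T x - T y| ≤ L * N (x - y)) {φ : ℝ → ℝ}
    (hshift : ∀ x t, (0 ≤ t ∨ ∃ s ∈ Ioo (0 : ℝ) 1, φ s < 0) →
      T (x + (σ x * t) • d) = T x + t * L)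
    (hφ : MonotoneOn φ (Ioo 0 1)) (hφi : IntegrableOn φ (Ioo 0 1)) :
    (⨆ F ∈ wassersteinBall N p F₀ ε, extIntegral (volume.restrict (Ioo (0 : ℝ) 1))
        (fun s => realQuantile (F.map T) s * φ s)) =
      extIntegral (volume.restrict (Ioo (0 : ℝ) 1)) (fun s => realQuantile (F₀.map T) s * φ s) +
        ((unitNorm q φ * ENNReal.ofReal (ε * L) : ℝ≥0∞) : EReal) := by
  have := hF₀.1
  have hprob := Measure.isProbabilityMeasure_map (μ := F₀) hT.aemeasurable
  refine le_antisymm (iSup₂_le fun F hF => extIntegral_le_of_mem_wassersteinBall hF₀ hF hT hL0 hL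
    (hTi _ hF₀) (hTi _ hF.1) hφ hφi) ?_
  set S := ⨆ F ∈ wassersteinBall N p F₀ ε, extIntegral (volume.restrict (Ioo (0 : ℝ) 1))
        (fun s => realQuantile (F.map T) s * φ s) with hS
  have hself : extIntegral (volume.restrict (Ioo (0 : ℝ) 1))
      (fun s => realQuantile (F₀.map T) s * φ s) ≤ S :=
    le_iSup₂ (f := fun F (_ : F ∈ wassersteinBall N p F₀ ε) =>
      extIntegral (volume.restrict (Ioo (0 : ℝ) 1)) (fun s => realQuantile (F.map T) s * φ s))
      F₀ (self_mem_wassersteinBall hN hF₀)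
  have hgi : Integrable id (F₀.map T) :=
    (integrable_map_measure aestronglyMeasurable_id hT.aemeasurable).mpr (hTi _ hF₀)
  by_cases hint : IntegrableOn (fun s => realQuantile (F₀.map T) s * φ s) (Ioo 0 1)
  swap
  · rw [extIntegral_eq_top (f := fun s => realQuantile (F₀.map T) s * φ s)
      (measurable_realQuantile.aemeasurable.mul hφi.aemeasurable)
      (lintegral_neg_mul_ne_top_of_monotoneOn monotoneOn_realQuantile hφ
        (integrable_realQuantile hgi) hφi) hint, top_le_iff] at hself
    rw [hself]
    exact le_top
  rw [extIntegral_eq_integral (f := fun s => realQuantile (F₀.map T) s * φ s) hint] at hself ⊢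
  set a := ∫ s in Ioo 0 1, realQuantile (F₀.map T) s * φ s with ha
  rcases eq_or_ne S ⊤ with hStop | hStop
  · rw [hStop]; exact le_top
  have hSbot : S ≠ ⊥ := fun h => by simp [h] at hself
  lift S to ℝ using ⟨hStop, hSbot⟩ with b hb
  rw [EReal.coe_le_coe_iff] at hself
  have hLε : 0 ≤ ε * L := mul_nonneg hε hL0
  have hK : unitNorm q φ * ENNReal.ofReal (ε * L) ≤ ENNReal.ofReal (b - a) := by
    -- Here ‖φ‖_q may be infinite, and the convention ∞ · 0 = 0 settles the case.
    rcases eq_or_ne (ENNReal.ofReal (ε * L)) 0 with h0 | h0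
    · rw [h0, mul_zero]; exact bot_le
    rw [← ENNReal.le_div_iff_mul_le (Or.inl h0) (Or.inl ENNReal.ofReal_ne_top)]
    refine le_of_forall_lt fun c hc => ?_
    -- Duality yields only a weak inequality at c'; the gap between c and c' makes it strict at c.
    obtain ⟨c', hcc', hc'⟩ := exists_between hc
    refine hcc'.trans_le ?_
    obtain ⟨w, hwm, ⟨C, hC⟩, hwφ, hw1, hwc⟩ := exists_dual (p := p) hφi hc'
    obtain ⟨F, hF, hFle⟩ := exists_mem_wassersteinBall_le_extIntegral hN hε hF₀ hT hσ hTi hσ1 hd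
      hshift hφ hφi hint hwm hC hwφ hw1
    have hFS : extIntegral (volume.restrict (Ioo (0 : ℝ) 1))
        (fun s => realQuantile (F.map T) s * φ s) ≤ (b : EReal) := by
      rw [hb]
      exact le_iSup₂ (f := fun F (_ : F ∈ wassersteinBall N p F₀ ε) =>
        extIntegral (volume.restrict (Ioo (0 : ℝ) 1)) (fun s => realQuantile (F.map T) s * φ s))
        F hF
    have hreal := EReal.coe_le_coe_iff.mp (hFle.trans hFS)
    rw [ENNReal.le_div_iff_mul_le (Or.inl h0) (Or.inl ENNReal.ofReal_ne_top)]
    calc c' * ENNReal.ofReal (ε * L)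
        ≤ ENNReal.ofReal (∫ s in Ioo 0 1, w s * φ s) * ENNReal.ofReal (ε * L) := by gcongr
      _ = ENNReal.ofReal ((∫ s in Ioo 0 1, w s * φ s) * (ε * L)) :=
          (ENNReal.ofReal_mul' hLε).symm
      _ ≤ ENNReal.ofReal (b - a) := ENNReal.ofReal_le_ofReal (by linarith)
  calc (a : EReal) + ((unitNorm q φ * ENNReal.ofReal (ε * L) : ℝ≥0∞) : EReal)
      ≤ (a : EReal) + ((ENNReal.ofReal (b - a) : ℝ≥0∞) : EReal) := by
        gcongr
        exact EReal.coe_ennreal_le_coe_ennreal_iff.mpr hK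
    _ = (b : EReal) := by
        rw [EReal.coe_ennreal_ofReal, max_eq_left (sub_nonneg.mpr hself), ← EReal.coe_add]
        congr 1
        ring

end Lower

/-! ### Norms on `ℝⁿ` and their duals -/

section Norm

variable {n : ℕ} {N : Seminorm ℝ (Fin n → ℝ)}

theorem continuous_seminorm : Continuous N :=
  continuousOn_univ.mp (N.convexOn.continuousOn isOpen_univ)

theorem exists_pos_mul_norm_le (hN : ∀ x, N x = 0 → x = 0) : ∃ c > 0, ∀ x, c * ‖x‖ ≤ N x := by
  -- The sphere is empty exactly when n = 0; otherwise the constant is the minimum of `N` on it.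
  rcases (Metric.sphere (0 : Fin n → ℝ) 1).eq_empty_or_nonempty with h | h
  · refine ⟨1, one_pos, fun x => ?_⟩
    have : x = 0 := by
      by_contra hx
      have hmem : ‖x‖⁻¹ • x ∈ Metric.sphere (0 : Fin n → ℝ) 1 := by
        simp [norm_smul, hx]
      rw [h] at hmem
      exact hmem
    simp [this]
  · obtain ⟨y, hy, hmin⟩ := (isCompact_sphere (0 : Fin n → ℝ) 1).exists_isMinOn h
      (continuous_seminorm (N := N)).continuousOn
    have hy0 : y ≠ 0 := fun h0 => by simp [h0] at hy
    refine ⟨N y, lt_of_le_of_ne (apply_nonneg N y) fun h0 => hy0 (hN y h0.symm), fun x => ?_⟩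
    rcases eq_or_ne x 0 with rfl | hx
    · simp
    have hmem : ‖x‖⁻¹ • x ∈ Metric.sphere (0 : Fin n → ℝ) 1 := by
      simp [norm_smul, hx]
    have hle : N y ≤ N (‖x‖⁻¹ • x) := hmin hmem
    have hxpos : 0 < ‖x‖ := norm_pos_iff.mpr hx
    rw [map_smul_eq_mul, norm_inv, norm_norm, inv_mul_eq_div, le_div_iff₀ hxpos] at hle
    exact hle

theorem isCompact_unitBall (hN : ∀ x, N x = 0 → x = 0) : IsCompact {x | N x ≤ 1} := by
  obtain ⟨c, hc, hcN⟩ := exists_pos_mul_norm_le hN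
  refine Metric.isCompact_of_isClosed_isBounded (isClosed_le continuous_seminorm continuous_const)
    ((Metric.isBounded_closedBall (x := (0 : Fin n → ℝ)) (r := c⁻¹)).subset fun x hx => ?_)
  rw [mem_closedBall_zero_iff, ← one_div, le_div_iff₀' hc]
  exact (hcN x).trans hx

/-- Compactness of the unit ball gives a maximiser d; attainment makes a shift by t along d change
y·x by exactly t‖y‖_*. -/
theorem exists_dotProduct_eq_dualNorm (hN : ∀ x, N x = 0 → x = 0) (y : Fin n → ℝ) :
    ∃ d, N d ≤ 1 ∧ y ⬝ᵥ d = dualNorm N y ∧ ∀ x, N x ≤ 1 → y ⬝ᵥ x ≤ dualNorm N y := by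
  have hc : Continuous fun x : Fin n → ℝ => x ⬝ᵥ y := by
    simp only [dotProduct]; fun_prop
  obtain ⟨d, hd, hd1, hd2⟩ := (isCompact_unitBall hN).exists_sSup_image_eq_and_ge ⟨0, by simp⟩
    hc.continuousOn
  refine ⟨d, hd, ?_, fun x hx => ?_⟩
  · rw [dotProduct_comm, dualNorm, hd1]
  · rw [dotProduct_comm, dualNorm, hd1]
    exact hd2 x hx

theorem dualNorm_nonneg (hN : ∀ x, N x = 0 → x = 0) (y : Fin n → ℝ) : 0 ≤ dualNorm N y := by
  obtain ⟨d, -, -, h⟩ := exists_dotProduct_eq_dualNorm hN y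
  simpa using h 0 (by simp)

theorem dotProduct_le_dualNorm_mul (hN : ∀ x, N x = 0 → x = 0) (y x : Fin n → ℝ) :
    y ⬝ᵥ x ≤ dualNorm N y * N x := by
  obtain ⟨d, -, -, h⟩ := exists_dotProduct_eq_dualNorm hN y
  rcases (apply_nonneg N x).eq_or_lt with h0 | h0
  · rw [hN x h0.symm]; simp
  · have h1 : N ((N x)⁻¹ • x) ≤ 1 := by
      rw [map_smul_eq_mul, norm_inv, Real.norm_of_nonneg h0.le, inv_mul_cancel₀ h0.ne']
    have h2 := h _ h1
    rw [dotProduct_smul, smul_eq_mul, inv_mul_eq_div, div_le_iff₀ h0] at h2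
    exact h2

theorem abs_dotProduct_le_dualNorm_mul (hN : ∀ x, N x = 0 → x = 0) (y x : Fin n → ℝ) :
    |y ⬝ᵥ x| ≤ dualNorm N y * N x := by
  rw [abs_le']
  refine ⟨dotProduct_le_dualNorm_mul hN y x, ?_⟩
  have := dotProduct_le_dualNorm_mul hN y (-x)
  rwa [dotProduct_neg, map_neg_eq_map] at this

end Norm

/-! ### The two risk functionals -/

section Risk

variable {n : ℕ} {N : Seminorm ℝ (Fin n → ℝ)} {p q : ℝ≥0∞} {F₀ F : Measure (Fin n → ℝ)} {ε : ℝ}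
  {h : ℝ → ℝ}

theorem measurable_dotProduct (β : Fin n → ℝ) : Measurable fun x : Fin n → ℝ => β ⬝ᵥ x := by
  simp only [dotProduct]
  fun_prop

theorem integrable_dotProduct (hp : 1 ≤ p) (hF : F ∈ finiteMoment p) (β : Fin n → ℝ) :
    Integrable (fun x => β ⬝ᵥ x) F := by
  have := hF.1
  simp only [dotProduct]
  exact integrable_finsetSum _ fun i _ => ((hF.2 i).integrable hp).const_mul _

/-- With g the quantile function of β·X and m its mean, (g - m)h'₋ equals g(h'₋ + h(0) - h(1)) plus
(h(1) - h(0))g - m h'₋, and the latter integrates to zero. -/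
theorem deviationRisk_eq_extIntegral (hp : 1 ≤ p) (hconv : ConvexOn ℝ (Icc 0 1) h)
    (hcont : ContinuousOn h (Icc 0 1)) (hF : F ∈ finiteMoment p) (β : Fin n → ℝ) :
    deviationRisk h F β = extIntegral (volume.restrict (Ioo (0 : ℝ) 1))
      (fun s => realQuantile (F.map fun x => β ⬝ᵥ x) s * (leftDeriv h s + h 0 - h 1)) := by
  have := hF.1
  have hTm := measurable_dotProduct β
  have hprob := Measure.isProbabilityMeasure_map (μ := F) hTm.aemeasurable
  set μ := F.map fun x => β ⬝ᵥ x with hμ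
  set m := ∫ y, (β ⬝ᵥ y) ∂F with hm
  have hmeas : Measurable fun x : ℝ => x - m := by fun_prop
  have hprob' := Measure.isProbabilityMeasure_map (μ := μ) hmeas.aemeasurable
  have hmap : F.map (fun x => (β ⬝ᵥ x) - m) = μ.map fun x => x - m :=
    (Measure.map_map hmeas hTm).symm
  have hμi : Integrable id μ := (integrable_map_measure aestronglyMeasurable_id
    hTm.aemeasurable).mpr (integrable_dotProduct hp hF β)
  have hgi : IntegrableOn (realQuantile μ) (Ioo 0 1) := integrable_realQuantile hμi
  have hh' : IntegrableOn (leftDeriv h) (Ioo 0 1) := integrableOn_leftDeriv hconv hcont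
  have hg : ∫ s in Ioo 0 1, realQuantile μ s = m := by
    rw [integral_realQuantile, hμ]
    exact integral_map hTm.aemeasurable aestronglyMeasurable_id
  have hh : ∫ s in Ioo 0 1, leftDeriv h s = h 1 - h 0 := by
    rw [← integral_leftDeriv hconv hcont le_rfl zero_le_one le_rfl,
      intervalIntegral.integral_of_le zero_le_one, integral_Ioc_eq_integral_Ioo]
  have hφi : IntegrableOn (fun s => leftDeriv h s + h 0 - h 1) (Ioo 0 1) :=
    (hh'.add (integrable_const (h 0))).sub (integrable_const (h 1))
  have hφ : MonotoneOn (fun s => leftDeriv h s + h 0 - h 1) (Ioo 0 1) := fun s hs t ht hst => by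
    have := monotoneOn_leftDeriv hconv hs ht hst
    simp only
    linarith
  rw [deviationRisk, ← hm, hmap, distortion_eq_extIntegral hconv hcont,
    ← extIntegral_add_of_integral_eq_zero
      (f := fun s => realQuantile μ s * (leftDeriv h s + h 0 - h 1))
      (g := fun s => (h 1 - h 0) * realQuantile μ s - m * leftDeriv h s)
      (measurable_realQuantile.aemeasurable.mul hφi.aemeasurable)
      (lintegral_neg_mul_ne_top_of_monotoneOn monotoneOn_realQuantile hφ hgi hφi)
      ((hgi.const_mul _).sub (hh'.const_mul _))]
  · refine extIntegral_congr ?_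
    filter_upwards [ae_restrict_mem measurableSet_Ioo] with s hs
    rw [realQuantile_map_sub_const m hs]
    ring
  · rw [integral_sub (hgi.const_mul _) (hh'.const_mul _), integral_const_mul, integral_const_mul,
      hg, hh]
    ring

theorem absoluteRisk_eq_extIntegral (hconv : ConvexOn ℝ (Icc 0 1) h)
    (hcont : ContinuousOn h (Icc 0 1)) (hF : F ∈ finiteMoment p) (β : Fin n → ℝ) :
    absoluteRisk h F β = extIntegral (volume.restrict (Ioo (0 : ℝ) 1))
      (fun s => realQuantile (F.map fun x => |β ⬝ᵥ x|) s * leftDeriv h s) := by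
  have := hF.1
  have := Measure.isProbabilityMeasure_map (μ := F) (measurable_dotProduct β).abs.aemeasurable
  exact distortion_eq_extIntegral hconv hcont

variable [p.HolderConjugate q] (hN : ∀ x, N x = 0 → x = 0) (hp : 1 ≤ p)
  (hF₀ : F₀ ∈ finiteMoment p) (hε : 0 ≤ ε) (hconv : ConvexOn ℝ (Icc 0 1) h)
  (hcont : ContinuousOn h (Icc 0 1))
include hN hp hF₀ hε hconv hcont

theorem iSup_deviationRisk_eq (β : Fin n → ℝ) :
    (⨆ F ∈ wassersteinBall N p F₀ ε, deviationRisk h F β) =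
      deviationRisk h F₀ β +
        ((unitNorm q (fun s => leftDeriv h s + h 0 - h 1) *
          ENNReal.ofReal (ε * dualNorm N β) : ℝ≥0∞) : EReal) := by
  obtain ⟨d, hd, hdβ, -⟩ := exists_dotProduct_eq_dualNorm hN β
  rw [deviationRisk_eq_extIntegral hp hconv hcont hF₀ β]
  refine Eq.trans (biSup_congr fun F hF => deviationRisk_eq_extIntegral hp hconv hcont hF.1 β)
    (iSup_extIntegral_eq (σ := fun _ => 1) continuous_seminorm hε hF₀ (measurable_dotProduct β)
      measurable_const (fun F hF => integrable_dotProduct hp hF β) (by simp) hd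
      (dualNorm_nonneg hN β) (fun x y => ?_) (fun x t _ => ?_) (fun s hs t ht hst => ?_) ?_)
  · rw [← dotProduct_sub]
    exact abs_dotProduct_le_dualNorm_mul hN β _
  · rw [one_mul, dotProduct_add, dotProduct_smul, hdβ, smul_eq_mul]
  · have := monotoneOn_leftDeriv hconv hs ht hst
    linarith
  · exact ((integrableOn_leftDeriv hconv hcont).add (integrable_const (h 0))).sub
      (integrable_const (h 1))

theorem iSup_absoluteRisk_eq (hmono : MonotoneOn h (Icc 0 1)) (β : Fin n → ℝ) :
    (⨆ F ∈ wassersteinBall N p F₀ ε, absoluteRisk h F β) =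
      absoluteRisk h F₀ β +
        ((unitNorm q (leftDeriv h) * ENNReal.ofReal (ε * dualNorm N β) : ℝ≥0∞) : EReal) := by
  obtain ⟨d, hd, hdβ, -⟩ := exists_dotProduct_eq_dualNorm hN β
  have hdual := dualNorm_nonneg hN β
  have hset : MeasurableSet {x : Fin n → ℝ | β ⬝ᵥ x < 0} :=
    measurableSet_lt (measurable_dotProduct β) measurable_const
  rw [absoluteRisk_eq_extIntegral hconv hcont hF₀ β]
  refine Eq.trans (biSup_congr fun F hF => absoluteRisk_eq_extIntegral hconv hcont hF.1 β)
    (iSup_extIntegral_eq (σ := fun x => if β ⬝ᵥ x < 0 then -1 else 1) continuous_seminorm hε hF₀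
      (measurable_dotProduct β).abs (Measurable.ite hset measurable_const measurable_const)
      (fun F hF => (integrable_dotProduct hp hF β).abs) (fun x => ?_) hd hdual (fun x y => ?_)
      (fun x t ht => ?_) (monotoneOn_leftDeriv hconv) (integrableOn_leftDeriv hconv hcont))
  · split_ifs <;> simp
  · refine (abs_abs_sub_abs_le_abs_sub _ _).trans ?_
    rw [← dotProduct_sub]
    exact abs_dotProduct_le_dualNorm_mul hN β _
  -- Convexity bounds h'₋(s) below by the slope of `h` from 0 to s, which is nonnegative for
  -- increasing `h`; so φ is never negative and only t ≥ 0 remains. Such a shift along σ(x)d keeps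
  -- the sign of β·x, up to the value 0, and adds t‖β‖_* to its absolute value.
  · have ht0 : 0 ≤ t := by
      rcases ht with ht | ⟨s, hs, hs'⟩
      · exact ht
      · have h0 : (0 : ℝ) ∈ Icc (0 : ℝ) 1 := ⟨le_rfl, zero_le_one⟩
        have hsI : s ∈ Icc (0 : ℝ) 1 := Ioo_subset_Icc_self hs
        have h1 := hconv.slope_le_of_hasDerivWithinAt_Iio h0 hsI hs.1
          (hasDerivWithinAt_leftDeriv hconv hs)
        have h2 : 0 ≤ slope h 0 s := by
          rw [slope_def_field]
          exact div_nonneg (sub_nonneg.mpr (hmono h0 hsI hs.1.le)) (by linarith [hs.1])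
        linarith
    have htd : 0 ≤ t * dualNorm N β := mul_nonneg ht0 hdual
    rw [dotProduct_add, dotProduct_smul, hdβ, smul_eq_mul]
    split_ifs with hx
    · rw [abs_of_neg hx, abs_of_nonpos (by linarith)]
      ring
    · rw [abs_of_nonneg (not_lt.mp hx), abs_of_nonneg (by linarith [not_lt.mp hx])]
      ring

end Risk

end WassersteinDRO

/-! ### Both identities and their infima. -/

theorem proposition2 {n : ℕ}
    (N : Seminorm ℝ (Fin (n + 1) → ℝ)) (hN : ∀ x, N x = 0 → x = 0)
    (p q : ℝ≥0∞) (hp : 1 ≤ p) (hpq : p⁻¹ + q⁻¹ = 1)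
    (F₀ : Measure (Fin (n + 1) → ℝ)) (hF₀ : F₀ ∈ finiteMoment p)
    (ε : ℝ) (hε : 0 ≤ ε)
    (h : ℝ → ℝ) (hconv : ConvexOn ℝ (Icc 0 1) h) (hcont : ContinuousOn h (Icc 0 1)) :
    ((∀ β : Fin (n + 1) → ℝ,
        (⨆ F ∈ wassersteinBall N p F₀ ε, deviationRisk h F β) =
          deviationRisk h F₀ β +
            ((unitNorm q (fun s => leftDeriv h s + h 0 - h 1) *
              ENNReal.ofReal (ε * dualNorm N β) : ℝ≥0∞) : EReal)) ∧
      (∀ D : Set (Fin (n + 1) → ℝ),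
        (⨅ β ∈ D, ⨆ F ∈ wassersteinBall N p F₀ ε, deviationRisk h F β) =
          ⨅ β ∈ D, (deviationRisk h F₀ β +
            ((unitNorm q (fun s => leftDeriv h s + h 0 - h 1) *
              ENNReal.ofReal (ε * dualNorm N β) : ℝ≥0∞) : EReal)))) ∧
    (MonotoneOn h (Icc 0 1) →
      (∀ βr : Fin n → ℝ,
        (⨆ F ∈ wassersteinBall N p F₀ ε, absoluteRisk h F (Matrix.vecCons 1 (-βr))) =
          absoluteRisk h F₀ (Matrix.vecCons 1 (-βr)) +
            ((unitNorm q (leftDeriv h) *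
              ENNReal.ofReal (ε * dualNorm N (Matrix.vecCons 1 (-βr))) : ℝ≥0∞) : EReal)) ∧
      (∀ D : Set (Fin n → ℝ),
        (⨅ βr ∈ D, ⨆ F ∈ wassersteinBall N p F₀ ε, absoluteRisk h F (Matrix.vecCons 1 (-βr))) =
          ⨅ βr ∈ D, (absoluteRisk h F₀ (Matrix.vecCons 1 (-βr)) +
            ((unitNorm q (leftDeriv h) *
              ENNReal.ofReal (ε * dualNorm N (Matrix.vecCons 1 (-βr))) : ℝ≥0∞) : EReal)))) := by
  have : p.HolderConjugate q := ENNReal.holderConjugate_iff.mpr hpq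
  refine ⟨⟨iSup_deviationRisk_eq hN hp hF₀ hε hconv hcont, fun D => ?_⟩, fun hmono =>
    ⟨fun βr => iSup_absoluteRisk_eq hN hp hF₀ hε hconv hcont hmono _, fun D => ?_⟩⟩
  · exact biInf_congr fun β _ => iSup_deviationRisk_eq hN hp hF₀ hε hconv hcont β
  · exact biInf_congr fun βr _ => iSup_absoluteRisk_eq hN hp hF₀ hε hconv hcont hmono _
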